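/- Let $\mathbb S^1=\mathbb R/\mathbb Z$ (with Lebesgue measure of total mass $1$), let $\mathcal P(\mathbb S^1)$ be the set of Borel probability measures on $\mathbb S^1$ and $\mathfrak M(\mathbb S^1)$ the space of finite signed Borel (Radon) measures. For $\mu\in\mathcal P(\mathbb S^1)$, $\mathfrak m\in\mathfrak M(\mathbb S^1)$ set $$\mathfrak a(\mu,\mathfrak m)=\int_{\mathbb S^1}\Bigl|\frac{d\mathfrak m}{d\mu}\Bigr|^2\,d\mu\ \text{ if }\mathfrak m\ll\mu,\qquad \mathfrak a(\mu,\mathfrak m)=+\infty\ \text{ otherwise.}$$ For $\mu^0,\mu^1\in\mathcal P(\mathbb S^1)$ let $\mathcal{CE}(\mu^0,\mu^1)$ be the set of families $(\mu^s,\mathfrak m^s)_{s\in[0,1]}$ with $\mu^s\in\mathcal P(\mathbb S^1)$, $\mathfrak m^s\in\mathfrak M(\mathbb S^1)$, measurable in $s$, with $s\mapsto\mu^s$ weakly continuous on $[0,1]$ and equal to $\mu^0$ at $s=0$ and to $\mu^1$ at $s=1$, which satisfy $\partial_s\mu^s=\partial_{xx}\mathfrak m^s$ in the sense of distributions on $(0,1)\times\mathbb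 S^1$ and have finite action $\mathfrak A[(\mu^s,\mathfrak m^s)_s]:=\int_0^1\mathfrak a(\mu^s,\mathfrak m^s)\,ds<\infty$. Define $$\mathbb D(\mu^0,\mu^1)=\inf_{(\mu^s,\mathfrak m^s)_s\in\mathcal{CE}(\mu^0,\mu^1)}\mathfrak A\bigl[(\mu^s,\mathfrak m^s)_s\bigr]^{1/2}.$$ For $p\in\{2,\infty\}$ let $\dot W^{2,p}(\mathbb S^1)=\{f\in W^{2,p}(\mathbb S^1):\int f\,dx=0\}$, normed by $\|\partial_{xx}f\|_{L^p}$, and for a signed measure $\nu$ of zero total mass let $$\|\nu\|_{(\dot W^{2,p})'}=\sup\Bigl\{\Bigl|\int f\,d\nu\Bigr| : f\in\dot W^{2,p}(\mathbb S^1),\ \|\partial_{xx}f\|_{L^p}\le1\Bigr\},$$ where $f$ is taken in its continuous representative; write $\|\nu\|_{\dot H^{-2}}=\|\nu\|_{(\dot W^{2,2})'}$. Then $\mathbb D$ is a (finite) metric on $\mathcal P(\mathbb S^1)$; it induces the topology of weak convergence of measures; $(\mathcal P(\mathbb S^1),\mathbb D)$ is complete; and it is a geodesic space: for all $\mu^0,\mu^1$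 there is a curve $(\gamma_s)_{s\in[0,1]}$ in $\mathcal P(\mathbb S^1)$ with $\gamma_0=\mu^0$, $\gamma_1=\mu^1$ and $\mathbb D(\gamma_s,\gamma_t)=|s-t|\,\mathbb D(\mu^0,\mu^1)$ for all $s,t\in[0,1]$. Moreover, for all $\mu^0,\mu^1\in\mathcal P(\mathbb S^1)$ one has $\|\mu^1-\mu^0\|_{\dot H^{-2}}<1$ and $$\|\mu^0-\mu^1\|_{(\dot W^{2,\infty})'}^2\ \le\ \mathbb D(\mu^0,\mu^1)^2\ \le\ 2\bigl(-\log\|\mu^1-\mu^0\|_{\dot H^{-2}}^2\bigr)^{-1},$$ where the right-hand side is read as $0$ if $\mu^0=\mu^1$. -/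

import Mathlib

open MeasureTheory Set
open scoped ENNReal ContDiff

noncomputable section

/-- Smooth real functions on the circle `ℝ/ℤ` (smooth after lifting to the universal cover `ℝ`). -/
def CircleSmooth (f : UnitAddCircle → ℝ) : Prop :=
  ContDiff ℝ ∞ (fun t : ℝ => f (t : UnitAddCircle))

/-- The derivative `∂ₓ f` of a function on the circle `ℝ/ℤ`. -/
def circleDeriv (f : UnitAddCircle → ℝ) : UnitAddCircle → ℝ :=
  fun x => deriv (fun t : ℝ => f (x + (t : UnitAddCircle))) 0

/-- Test functions on `(0,1) × 𝕊¹`: smooth, with compact support in `(0,1) × 𝕊¹`. -/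
def IsTestFunction (φ : ℝ → UnitAddCircle → ℝ) : Prop :=
  ContDiff ℝ ∞ (fun p : ℝ × ℝ => φ p.1 (p.2 : UnitAddCircle)) ∧
    ∃ a b : ℝ, 0 < a ∧ b < 1 ∧ ∀ s, s ∉ Icc a b → ∀ x, φ s x = 0

open Classical in
/-- The action density `𝔞(μ, 𝔪) = ∫ |d𝔪/dμ|² dμ` if `𝔪 ≪ μ`, and `+∞` otherwise. -/
def actionDensity (μ : ProbabilityMeasure UnitAddCircle) (m : SignedMeasure UnitAddCircle) :
    ℝ≥0∞ :=
  if m ≪ᵥ (μ : Measure UnitAddCircle).toENNRealVectorMeasure then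
    ∫⁻ x, ENNReal.ofReal ((m.rnDeriv (μ : Measure UnitAddCircle) x) ^ 2)
      ∂(μ : Measure UnitAddCircle)
  else ⊤

/-- The action `𝔄[(μˢ, 𝔪ˢ)] = ∫₀¹ 𝔞(μˢ, 𝔪ˢ) ds`. -/
def action (μ : ℝ → ProbabilityMeasure UnitAddCircle) (m : ℝ → SignedMeasure UnitAddCircle) :
    ℝ≥0∞ :=
  ∫⁻ s in Icc (0 : ℝ) 1, actionDensity (μ s) (m s)

/-- The second-order continuity equation `∂ₛ μˢ = ∂ₓₓ 𝔪ˢ` on `(0,1) × 𝕊¹` in the sense of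
distributions. -/
def SolvesContinuityEq (μ : ℝ → ProbabilityMeasure UnitAddCircle)
    (m : ℝ → SignedMeasure UnitAddCircle) : Prop :=
  ∀ φ : ℝ → UnitAddCircle → ℝ, IsTestFunction φ →
    (∫ s in Icc (0 : ℝ) 1, ∫ x, deriv (fun r => φ r x) s ∂(μ s : Measure UnitAddCircle)) +
      (∫ s in Icc (0 : ℝ) 1, ∫ᵛ x, circleDeriv (circleDeriv (φ s)) x ∂•(m s)) = 0

/-- `𝒞ℰ(μ⁰, μ¹)`: the curves `(μˢ, 𝔪ˢ)`, `s ∈ [0,1]`, of finite action that connect `μ⁰` to `μ¹`,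
with `μˢ` in its weakly continuous version. Only the values for `s ∈ [0,1]` matter. -/
structure IsConnectingCurve (μ₀ μ₁ : ProbabilityMeasure UnitAddCircle)
    (μ : ℝ → ProbabilityMeasure UnitAddCircle) (m : ℝ → SignedMeasure UnitAddCircle) : Prop where
  continuousOn : ContinuousOn μ (Icc 0 1)
  measurable : ∀ B : Set UnitAddCircle, MeasurableSet B →
    Measurable (fun s : Icc (0 : ℝ) 1 => m s B)
  continuityEq : SolvesContinuityEq μ m
  finite_action : action μ m < ⊤
  initial : μ 0 = μ₀
  terminal : μ 1 = μ₁

/-- The diffusive transport distance `𝔻(μ⁰, μ¹)`, an infimum in `[0, ∞]`. -/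
def diffusiveDist (μ₀ μ₁ : ProbabilityMeasure UnitAddCircle) : ℝ≥0∞ :=
  ⨅ (μ : ℝ → ProbabilityMeasure UnitAddCircle) (m : ℝ → SignedMeasure UnitAddCircle)
    (_ : IsConnectingCurve μ₀ μ₁ μ m), action μ m ^ (1 / 2 : ℝ)

/-- The topology of weak convergence of probability measures on the circle (tested against
continuous functions), which is the topology that Mathlib puts on `ProbabilityMeasure`. -/
abbrev weakTopology : TopologicalSpace (ProbabilityMeasure UnitAddCircle) := inferInstance

/-- `g` is the weak derivative of `f` on the circle. -/
structure IsWeakDeriv (f g : UnitAddCircle → ℝ) : Prop where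
  integrable_left : Integrable f
  integrable_right : Integrable g
  integral_eq : ∀ ψ : UnitAddCircle → ℝ, CircleSmooth ψ →
    ∫ x, f x * circleDeriv ψ x = -∫ x, g x * ψ x

/-- `f` is (the continuous representative of) an element of the homogeneous Sobolev space
`Ẇ^{2,p}(𝕊¹) = {f ∈ W^{2,p}(𝕊¹) : ∫ f = 0}`, and `f₂` is its second weak derivative. -/
structure IsHomSobolev (p : ℝ≥0∞) (f : C(UnitAddCircle, ℝ)) (f₂ : UnitAddCircle → ℝ) : Prop where
  mean_zero : ∫ x, f x = 0
  memLp : MemLp f p volume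
  memLp_snd : MemLp f₂ p volume
  weakDeriv : ∃ f₁ : UnitAddCircle → ℝ,
    MemLp f₁ p volume ∧ IsWeakDeriv f f₁ ∧ IsWeakDeriv f₁ f₂

/-- The norm of a signed measure in the dual of `Ẇ^{2,p}(𝕊¹)`, where `‖f‖ = ‖∂ₓₓ f‖_{Lᵖ}`:
the supremum of `|⟨f, ν⟩|` over all `f` with `‖f‖ ≤ 1`. -/
def dualSobolevNorm (p : ℝ≥0∞) (ν : SignedMeasure UnitAddCircle) : ℝ≥0∞ :=
  ⨆ (f : C(UnitAddCircle, ℝ)) (f₂ : UnitAddCircle → ℝ) (_ : IsHomSobolev p f f₂)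
    (_ : eLpNorm f₂ p volume ≤ 1), ENNReal.ofReal |∫ᵛ x, f x ∂•ν|

/-- The difference `μ - ν` of two probability measures, as a signed measure. -/
def measureDiff (μ ν : ProbabilityMeasure UnitAddCircle) : SignedMeasure UnitAddCircle :=
  (μ : Measure UnitAddCircle).toSignedMeasure - (ν : Measure UnitAddCircle).toSignedMeasure

end

/-!
The distance is finite, and bounded above in terms of negative Sobolev norms, because of one explicit
curve. With the Green kernel `G` of the circle (`∂ₓₓ G = δ₀ - 1`), the potential `G ∗ μ` turns the
continuity equation into the transport of mass between `μ₀`, `μ₁` and the uniform measure `λ`: for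
weights `w₀ + w₁ + w₂ = 1` depending smoothly on time, the curve `w₀ μ₀ + w₁ μ₁ + w₂ λ` has the flux
`(w₀' G ∗ μ₀ + w₁' G ∗ μ₁) λ`. The uniform part, of weight `w₂ = δ sin² (π s)`, bounds the density
of the curve from below and makes the action finite (`diffusiveDist_sq_le_of_pos`). The optimal
choice of `δ`, proportional to the `L²` norm `N` of `g = G ∗ (μ₁ - μ₀)`, gives `𝔻² ≤ π² N / 4`
(`diffusiveDist_sq_le`). Since `N` is at most the norm of `μ₁ - μ₀` in `Ḣ⁻²`, which is at most
`1 / 8`, and `n log (1 / n) ≤ 1 / e < 4 / π²`, the logarithmic upper bound follows.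

For the lower bound, the distributional continuity equation is shown to hold up to the end points,
by the lemma of du Bois-Reymond (`IsConnectingCurve.integral_eq_add`). Tested with a smooth `ψ`, and
with the Cauchy–Schwarz inequality, it says that `|∫ ψ d(μ₁ - μ₀)|² ≤ sup |∂ₓₓ ψ|² · 𝔄`;
mollification extends this to the functions in `Ẇ^{2,∞}` (`dualSobolevNorm_top_le_diffusiveDist`).
In particular `𝔻` separates points. It is symmetric by time reversal and satisfies the triangle
inequality by concatenation, both instances of affine changes of time.

If `μ` converges weakly to `ν`, then `G ∗ (μ - ν)` converges to zero in `L²`, so that `𝔻` is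
continuous for the weak topology. That topology is compact, and a continuous metric on a compact
space metrizes it and is complete (`exists_metricSpace_of_compactSpace`).

For geodesics, no lower semicontinuity of the action is needed. On a curve whose action is at most
`𝔻² + ε`, near equality in the Cauchy–Schwarz inequality forces
`|𝔻(μˢ, μᵗ) - |s - t| 𝔻(μ₀, μ₁)|² ≤ ε` (`sq_toReal_diffusiveDist_sub_le`), and a pointwise limit of
such curves along an ultrafilter is a geodesic, by continuity of `𝔻`.
-/

/-! ### Integration against signed measures and the action density -/

instance isFiniteMeasure_variation_signedMeasure {X : Type*} [MeasurableSpace X]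
    (m : SignedMeasure X) : IsFiniteMeasure m.variation := by
  rw [← SignedMeasure.totalVariation_eq_variation]
  infer_instance

theorem signedIntegral_toSignedMeasure {X : Type*} [MeasurableSpace X] (μ : Measure X)
    [IsFiniteMeasure μ] (f : X → ℝ) : ∫ᵛ x, f x ∂•μ.toSignedMeasure = ∫ x, f x ∂μ := by
  rw [← VectorMeasure.integral_toSignedMeasure]
  congr 1
  ext
  simp

theorem integrable_of_measurable_of_bounded {X : Type*} [MeasurableSpace X] {μ : Measure X}
    [IsFiniteMeasure μ] {f : X → ℝ} (hf : Measurable f) {C : ℝ} (hC : ∀ x, |f x| ≤ C) :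
    Integrable f μ :=
  Integrable.of_bound hf.aestronglyMeasurable C (Filter.Eventually.of_forall hC)

theorem signedIntegral_withDensity {X : Type*} [MeasurableSpace X] (μ : Measure X)
    [IsFiniteMeasure μ] {f r : X → ℝ} (hf : Measurable f) {C : ℝ} (hC : ∀ x, |f x| ≤ C)
    (hr : Measurable r) (hri : Integrable r μ) :
    ∫ᵛ x, f x ∂•(μ.withDensityᵥ r) = ∫ x, r x * f x ∂μ := by
  rw [withDensityᵥ_eq_withDensity_pos_part_sub_withDensity_neg_part hri]
  have := isFiniteMeasure_withDensity_ofReal hri.2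
  have := isFiniteMeasure_withDensity_ofReal hri.neg.2
  have e : ∀ m : SignedMeasure X, m.Integrable f := fun m =>
    integrable_of_measurable_of_bounded hf hC
  rw [VectorMeasure.integral_sub_vectorMeasure (e _) (e _), signedIntegral_toSignedMeasure,
    signedIntegral_toSignedMeasure,
    integral_withDensity_eq_integral_toReal_smul hr.ennreal_ofReal (by simp),
    integral_withDensity_eq_integral_toReal_smul (f := fun x => ENNReal.ofReal (-r x))
      (by fun_prop) (by simp),
    ← integral_sub]
  · refine integral_congr_ae (Filter.Eventually.of_forall fun x => ?_)
    rcases le_total 0 (r x) with h | h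
    · simp [ENNReal.toReal_ofReal h, ENNReal.ofReal_of_nonpos (neg_nonpos.2 h)]
    · have h' : 0 ≤ -r x := neg_nonneg.2 h
      simp [ENNReal.toReal_ofReal h', ENNReal.ofReal_of_nonpos h]
  · refine (hri.pos_part.mul_bdd (c := C) hf.aestronglyMeasurable
      (Filter.Eventually.of_forall hC)).congr (Filter.Eventually.of_forall fun x => ?_)
    simp [ENNReal.toReal_ofReal']
  · refine (hri.neg.pos_part.mul_bdd (c := C) hf.aestronglyMeasurable
      (Filter.Eventually.of_forall hC)).congr (Filter.Eventually.of_forall fun x => ?_)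
    simp [ENNReal.toReal_ofReal']

/-- Cauchy–Schwarz: a finite action density controls the total variation of the flux. -/
theorem ofReal_sq_signedIntegral_le_actionDensity (μ : ProbabilityMeasure UnitAddCircle)
    (m : SignedMeasure UnitAddCircle) {f : UnitAddCircle → ℝ} (hf : Measurable f) {C : ℝ}
    (hC : ∀ x, |f x| ≤ C) :
    ENNReal.ofReal ((∫ᵛ x, f x ∂•m) ^ 2) ≤ ENNReal.ofReal (C ^ 2) * actionDensity μ m := by
  have hC0 : 0 ≤ C := (abs_nonneg _).trans (hC 0)
  unfold actionDensity
  split_ifs with hm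
  · set r := m.rnDeriv (μ : Measure UnitAddCircle) with hr
    have hrm : Measurable r := SignedMeasure.measurable_rnDeriv _ _
    have hri : Integrable r (μ : Measure UnitAddCircle) := SignedMeasure.integrable_rnDeriv _ _
    have e : ∫ᵛ x, f x ∂•m = ∫ x, r x * f x ∂(μ : Measure UnitAddCircle) := by
      conv_lhs => rw [← SignedMeasure.withDensityᵥ_rnDeriv_eq m _ hm]
      exact signedIntegral_withDensity _ hf hC hrm hri
    rw [e]
    have h1 : ENNReal.ofReal |∫ x, r x * f x ∂(μ : Measure UnitAddCircle)| ≤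
        ENNReal.ofReal C * ∫⁻ x, ENNReal.ofReal |r x| ∂(μ : Measure UnitAddCircle) := by
      rw [← Real.norm_eq_abs, ofReal_norm, ← lintegral_const_mul _ (by fun_prop)]
      refine (enorm_integral_le_lintegral_enorm _).trans (lintegral_mono fun x => ?_)
      rw [← ofReal_norm, ← ENNReal.ofReal_mul hC0, Real.norm_eq_abs, abs_mul, mul_comm]
      exact ENNReal.ofReal_le_ofReal (mul_le_mul_of_nonneg_right (hC x) (abs_nonneg _))
    have h2 : (∫⁻ x, ENNReal.ofReal |r x| ∂(μ : Measure UnitAddCircle)) ^ 2 ≤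
        ∫⁻ x, ENNReal.ofReal (r x ^ 2) ∂(μ : Measure UnitAddCircle) := by
      have := ENNReal.lintegral_mul_le_Lp_mul_Lq (μ : Measure UnitAddCircle)
        Real.HolderConjugate.two_two (f := fun x => ENNReal.ofReal |r x|) (g := fun _ => 1)
        (by fun_prop) (by fun_prop)
      simp only [Pi.mul_apply, mul_one, ENNReal.one_rpow, lintegral_one, measure_univ] at this
      calc _ ≤ ((∫⁻ x, ENNReal.ofReal |r x| ^ (2:ℝ) ∂(μ : Measure UnitAddCircle)) ^ (1/2:ℝ)) ^ 2 :=
            pow_le_pow_left' this 2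
        _ = ∫⁻ x, ENNReal.ofReal |r x| ^ (2:ℝ) ∂(μ : Measure UnitAddCircle) := by
            rw [← ENNReal.rpow_natCast, ← ENNReal.rpow_mul]; norm_num
        _ = _ := by
            refine lintegral_congr fun x => ?_
            rw [ENNReal.rpow_two, ← ENNReal.ofReal_pow (abs_nonneg _), sq_abs]
    calc _ = ENNReal.ofReal |∫ x, r x * f x ∂(μ : Measure UnitAddCircle)| ^ 2 := by
          rw [← ENNReal.ofReal_pow (abs_nonneg _), sq_abs]
      _ ≤ _ := pow_le_pow_left' h1 2
      _ = ENNReal.ofReal (C ^ 2) *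
          (∫⁻ x, ENNReal.ofReal |r x| ∂(μ : Measure UnitAddCircle)) ^ 2 := by
          rw [mul_pow, ENNReal.ofReal_pow hC0]
      _ ≤ _ := by gcongr
  · rcases hC0.eq_or_lt with rfl | h
    · have : f = 0 := by ext x; simpa using hC x
      simp [this]
    · rw [ENNReal.mul_top (by simpa using h.ne')]
      exact le_top

theorem actionDensity_zero (μ : ProbabilityMeasure UnitAddCircle) : actionDensity μ 0 = 0 := by
  have h0 : (0 : SignedMeasure UnitAddCircle) ≪ᵥ
    (μ : Measure UnitAddCircle).toENNRealVectorMeasure := VectorMeasure.AbsolutelyContinuous.zero _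
  rw [actionDensity, if_pos h0]
  have : (0 : SignedMeasure UnitAddCircle).rnDeriv (μ : Measure UnitAddCircle)
      =ᵐ[(μ : Measure UnitAddCircle)] 0 := by
    refine Integrable.ae_eq_of_withDensityᵥ_eq (SignedMeasure.integrable_rnDeriv _ _)
      (integrable_zero _ _ _) ?_
    rw [SignedMeasure.withDensityᵥ_rnDeriv_eq _ _ h0, withDensityᵥ_zero]
  rw [lintegral_congr_ae (g := 0)]
  · simp
  · filter_upwards [this] with x hx
    simp [hx]

theorem actionDensity_smul_le (μ : ProbabilityMeasure UnitAddCircle)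
    (m : SignedMeasure UnitAddCircle) (c : ℝ) :
    actionDensity μ (c • m) ≤ ENNReal.ofReal (c ^ 2) * actionDensity μ m := by
  rcases eq_or_ne c 0 with rfl | hc
  · simp [actionDensity_zero]
  by_cases hm : m ≪ᵥ (μ : Measure UnitAddCircle).toENNRealVectorMeasure
  · have hm' : (c • m) ≪ᵥ (μ : Measure UnitAddCircle).toENNRealVectorMeasure := by
      intro s hs
      simp [hm hs]
    rw [actionDensity, if_pos hm', actionDensity, if_pos hm,
      ← lintegral_const_mul _ (by
        have := m.measurable_rnDeriv (μ : Measure UnitAddCircle)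
        fun_prop)]
    refine lintegral_mono_ae ?_
    filter_upwards [m.rnDeriv_smul (μ : Measure UnitAddCircle) c] with x hx
    rw [hx, ← ENNReal.ofReal_mul (sq_nonneg c), Pi.smul_apply, smul_eq_mul, mul_pow]
  · simp only [actionDensity, if_neg hm]
    rw [ENNReal.mul_top (by simpa using hc)]
    exact le_top

/-- If the flux has a density `h` with respect to a measure `κ` which is at most `c μ`, then its
action density is at most `c ∫ h² dκ`. -/
theorem actionDensity_withDensity_le (μ : ProbabilityMeasure UnitAddCircle)
    (κ : Measure UnitAddCircle) [IsFiniteMeasure κ] {c : ℝ≥0∞} (hc : c ≠ ⊤)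
    (hκ : κ ≤ c • (μ : Measure UnitAddCircle)) {h : UnitAddCircle → ℝ} (hh : Measurable h)
    (hi : Integrable h κ) :
    actionDensity μ (κ.withDensityᵥ h) ≤ c * ∫⁻ x, ENNReal.ofReal (h x ^ 2) ∂κ := by
  have hac : κ ≪ (μ : Measure UnitAddCircle) :=
    (Measure.absolutelyContinuous_of_le hκ).trans (Measure.smul_absolutelyContinuous)
  have := Measure.haveLebesgueDecomposition_of_sigmaFinite κ (μ : Measure UnitAddCircle)
  set p := κ.rnDeriv (μ : Measure UnitAddCircle) with hp
  have hpm : Measurable p := Measure.measurable_rnDeriv _ _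
  have e := withDensityᵥ_rnDeriv_smul hac hi
  have hpi : Integrable (fun x => (p x).toReal • h x) (μ : Measure UnitAddCircle) :=
    (integrable_rnDeriv_smul_iff hac).mpr hi
  have hm : κ.withDensityᵥ h ≪ᵥ (μ : Measure UnitAddCircle).toENNRealVectorMeasure := by
    rw [← e]
    exact Measure.withDensityᵥ_absolutelyContinuous _ _
  have hle : p ≤ᵐ[(μ : Measure UnitAddCircle)] fun _ => c := by
    refine ae_le_of_forall_setLIntegral_le_of_sigmaFinite hpm fun s hs _ => ?_
    rw [Measure.setLIntegral_rnDeriv hac, setLIntegral_const]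
    simpa using hκ s
  rw [actionDensity, if_pos hm]
  have hr : SignedMeasure.rnDeriv (κ.withDensityᵥ h) (μ : Measure UnitAddCircle)
      =ᵐ[(μ : Measure UnitAddCircle)] fun x => (p x).toReal • h x := by
    refine Integrable.ae_eq_of_withDensityᵥ_eq (SignedMeasure.integrable_rnDeriv _ _) hpi ?_
    rw [SignedMeasure.withDensityᵥ_rnDeriv_eq _ _ hm, e]
  rw [← lintegral_rnDeriv_mul hac (by fun_prop), ← lintegral_const_mul _ (by fun_prop)]
  refine lintegral_mono_ae ?_
  filter_upwards [hr, hle] with x hx hx'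
  have hpx : p x ≠ ⊤ := ne_top_of_le_ne_top hc hx'
  rw [hx, smul_eq_mul, mul_pow, ENNReal.ofReal_mul (sq_nonneg _), sq (p x).toReal,
    ENNReal.ofReal_mul ENNReal.toReal_nonneg, ENNReal.ofReal_toReal hpx, mul_assoc]
  gcongr

/-! ### Calculus on the circle -/

theorem UnitAddCircle.isOpenQuotientMap_coe :
    IsOpenQuotientMap (fun t : ℝ => (t : UnitAddCircle)) :=
  QuotientAddGroup.isOpenQuotientMap_mk

theorem UnitAddCircle.exists_coe_mem_Ico (x : UnitAddCircle) :
    ∃ t ∈ Ico (0 : ℝ) 1, (t : UnitAddCircle) = x := by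
  refine ⟨AddCircle.equivIco 1 0 x, ?_, AddCircle.coe_equivIco⟩
  simpa using (AddCircle.equivIco (1 : ℝ) 0 x).2

theorem circleDeriv_coe (f : UnitAddCircle → ℝ) (t : ℝ) :
    circleDeriv f (t : UnitAddCircle) = deriv (fun r : ℝ => f (r : UnitAddCircle)) t := by
  have := deriv_comp_const_add (fun r : ℝ => f (r : UnitAddCircle)) t 0
  simpa [circleDeriv] using this

theorem circleDeriv_comp_add_right (f : UnitAddCircle → ℝ) (y : UnitAddCircle) :
    circleDeriv (fun x => f (x + y)) = fun x => circleDeriv f (x + y) := by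
  ext x
  simp only [circleDeriv]
  congr 1
  ext t
  rw [add_right_comm]

theorem circleDeriv_const_mul (c : ℝ) (f : UnitAddCircle → ℝ) :
    circleDeriv (fun x => c * f x) = fun x => c * circleDeriv f x := by
  ext x
  simp only [circleDeriv]
  exact deriv_const_mul_field c

theorem circleDeriv_comp_const_sub (f : UnitAddCircle → ℝ) (x : UnitAddCircle) :
    circleDeriv (fun y => f (x - y)) = fun y => -circleDeriv f (x - y) := by
  ext y
  have := deriv_comp_neg (fun t : ℝ => f (x - y + (t : UnitAddCircle))) 0
  simp only [circleDeriv]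
  rw [neg_zero] at this
  rw [← this]
  congr 1
  ext t
  congr 1
  rw [AddCircle.coe_neg]
  abel

namespace CircleSmooth

variable {f : UnitAddCircle → ℝ}

theorem continuous (hf : CircleSmooth f) : Continuous f :=
  UnitAddCircle.isOpenQuotientMap_coe.continuous_comp_iff.1 (ContDiff.continuous hf)

theorem measurable (hf : CircleSmooth f) : Measurable f := hf.continuous.measurable

theorem deriv (hf : CircleSmooth f) : CircleSmooth (circleDeriv f) := by
  unfold CircleSmooth
  simp only [circleDeriv_coe]
  exact (contDiff_infty_iff_deriv.1 hf).2

theorem hasDerivAt (hf : CircleSmooth f) (t : ℝ) :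
    HasDerivAt (fun r : ℝ => f (r : UnitAddCircle)) (circleDeriv f (t : UnitAddCircle)) t := by
  rw [circleDeriv_coe]
  exact ((contDiff_infty_iff_deriv.1 hf).1 t).hasDerivAt

theorem comp_add_right (hf : CircleSmooth f) (y : UnitAddCircle) :
    CircleSmooth fun x => f (x + y) := by
  obtain ⟨s, -, rfl⟩ := y.exists_coe_mem_Ico
  have : ContDiff ℝ ∞ fun t : ℝ => f ((t + s : ℝ) : UnitAddCircle) :=
    ContDiff.comp (g := fun t : ℝ => f (t : UnitAddCircle)) hf (contDiff_id.add contDiff_const)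
  simpa [CircleSmooth] using this

theorem comp_const_sub (hf : CircleSmooth f) (x : UnitAddCircle) :
    CircleSmooth fun y => f (x - y) := by
  obtain ⟨s, -, rfl⟩ := x.exists_coe_mem_Ico
  have : ContDiff ℝ ∞ fun t : ℝ => f ((s - t : ℝ) : UnitAddCircle) :=
    ContDiff.comp (g := fun t : ℝ => f (t : UnitAddCircle)) hf (contDiff_const.sub contDiff_id)
  simpa [CircleSmooth] using this

end CircleSmooth

theorem Continuous.exists_abs_le_circle {f : UnitAddCircle → ℝ} (hf : Continuous f) :
    ∃ C, ∀ x, |f x| ≤ C := by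
  obtain ⟨C, hC⟩ := isCompact_univ.exists_bound_of_continuousOn (f := f) hf.continuousOn
  exact ⟨C, fun x => hC x (mem_univ x)⟩

theorem Continuous.integrable_circle {f : UnitAddCircle → ℝ} (hf : Continuous f)
    (μ : Measure UnitAddCircle) [IsFiniteMeasure μ] : Integrable f μ := by
  obtain ⟨C, hC⟩ := hf.exists_abs_le_circle
  exact integrable_of_measurable_of_bounded hf.measurable hC

theorem integral_circle_eq_intervalIntegral (f : UnitAddCircle → ℝ) :
    ∫ x, f x = ∫ t in (0 : ℝ)..1, f (t : UnitAddCircle) := by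
  simpa using (UnitAddCircle.intervalIntegral_preimage 0 f).symm

/-- A function of time and space which is smooth on the universal cover `ℝ × ℝ`. -/
def SpaceTimeSmooth (φ : ℝ → UnitAddCircle → ℝ) : Prop :=
  ContDiff ℝ ∞ (fun p : ℝ × ℝ => φ p.1 (p.2 : UnitAddCircle))

namespace SpaceTimeSmooth

variable {φ : ℝ → UnitAddCircle → ℝ}

theorem continuous (hφ : SpaceTimeSmooth φ) : Continuous (Function.uncurry φ) :=
  (IsOpenQuotientMap.id.prodMap UnitAddCircle.isOpenQuotientMap_coe).continuous_comp_iff.1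
    (ContDiff.continuous hφ)

theorem slice (hφ : SpaceTimeSmooth φ) (s : ℝ) : CircleSmooth (φ s) :=
  ContDiff.comp (g := fun p : ℝ × ℝ => φ p.1 (p.2 : UnitAddCircle)) hφ
    (contDiff_const.prodMk contDiff_id)

theorem contDiff_time (hφ : SpaceTimeSmooth φ) (x : UnitAddCircle) :
    ContDiff ℝ ∞ fun s => φ s x := by
  obtain ⟨t, -, rfl⟩ := x.exists_coe_mem_Ico
  exact ContDiff.comp (g := fun p : ℝ × ℝ => φ p.1 (p.2 : UnitAddCircle)) hφ
    (contDiff_id.prodMk contDiff_const)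

theorem hasDerivAt_time (hφ : SpaceTimeSmooth φ) (s : ℝ) (x : UnitAddCircle) :
    HasDerivAt (fun r => φ r x) (deriv (fun r => φ r x) s) s :=
  ((contDiff_infty_iff_deriv.1 (hφ.contDiff_time x)).1 s).hasDerivAt

theorem contDiff_fderiv_apply (hφ : SpaceTimeSmooth φ) (v : ℝ × ℝ) :
    ContDiff ℝ ∞ fun p : ℝ × ℝ =>
      fderiv ℝ (fun p : ℝ × ℝ => φ p.1 (p.2 : UnitAddCircle)) p v :=
  (ContDiff.fderiv_right hφ (by simp)).clm_apply contDiff_const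

theorem time_deriv (hφ : SpaceTimeSmooth φ) :
    SpaceTimeSmooth fun s x => deriv (fun r => φ r x) s := by
  unfold SpaceTimeSmooth
  convert hφ.contDiff_fderiv_apply (1, 0) using 2 with p
  have h : HasFDerivAt (fun p : ℝ × ℝ => φ p.1 (p.2 : UnitAddCircle)) _ p :=
    (ContDiff.differentiable hφ (by simp) p).hasFDerivAt
  have h2 : HasDerivAt (fun r : ℝ => ((r, p.2) : ℝ × ℝ)) (1, 0) p.1 :=
    (hasDerivAt_id _).prodMk (hasDerivAt_const _ _)
  exact (HasFDerivAt.comp_hasDerivAt p.1 (f := fun r : ℝ => ((r, p.2) : ℝ × ℝ)) h h2).deriv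

theorem space_deriv (hφ : SpaceTimeSmooth φ) :
    SpaceTimeSmooth fun s => circleDeriv (φ s) := by
  unfold SpaceTimeSmooth
  convert hφ.contDiff_fderiv_apply (0, 1) using 2 with p
  have h : HasFDerivAt (fun p : ℝ × ℝ => φ p.1 (p.2 : UnitAddCircle)) _ p :=
    (ContDiff.differentiable hφ (by simp) p).hasFDerivAt
  have h2 : HasDerivAt (fun r : ℝ => ((p.1, r) : ℝ × ℝ)) (0, 1) p.2 :=
    (hasDerivAt_const _ _).prodMk (hasDerivAt_id _)
  refine (circleDeriv_coe _ _).trans ?_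
  exact (HasFDerivAt.comp_hasDerivAt p.2 (f := fun r : ℝ => ((p.1, r) : ℝ × ℝ)) h h2).deriv

theorem comp_affine (hφ : SpaceTimeSmooth φ) (a b : ℝ) :
    SpaceTimeSmooth fun s => φ (a * s + b) :=
  ContDiff.comp (g := fun p : ℝ × ℝ => φ p.1 (p.2 : UnitAddCircle)) hφ
    (((contDiff_const.mul contDiff_fst).add contDiff_const).prodMk contDiff_snd)

theorem time_mul (hφ : SpaceTimeSmooth φ) {η : ℝ → ℝ} (hη : ContDiff ℝ ∞ η) :
    SpaceTimeSmooth fun s x => η s * φ s x :=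
  (hη.comp contDiff_fst).mul hφ

end SpaceTimeSmooth

theorem CircleSmooth.spaceTimeSmooth {f : UnitAddCircle → ℝ} (hf : CircleSmooth f) :
    SpaceTimeSmooth fun _ => f :=
  ContDiff.comp (g := fun t : ℝ => f (t : UnitAddCircle)) hf contDiff_snd

/-! ### The Green kernel -/

/-- The Green kernel `G` of `∂ₓₓ` on the circle, given by `G(t) = t (1 - t) / 2 - 1 / 16` for
`t ∈ [0, 1)`, so that `∂ₓₓ G = δ₀ - 1`. The additive constant is chosen so as to minimise the
supremum norm, which is `1 / 16`. -/
noncomputable def greenKernel : UnitAddCircle → ℝ :=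
  AddCircle.liftIco 1 0 fun t : ℝ => t * (1 - t) / 2 - 1 / 16

/-- The derivative `1 / 2 - t`, `t ∈ [0, 1)`, of the Green kernel. -/
noncomputable def sawtooth : UnitAddCircle → ℝ :=
  AddCircle.liftIco 1 0 fun t : ℝ => 1 / 2 - t

theorem greenKernel_coe {t : ℝ} (ht : t ∈ Ico (0 : ℝ) 1) :
    greenKernel (t : UnitAddCircle) = t * (1 - t) / 2 - 1 / 16 :=
  AddCircle.liftIco_zero_coe_apply ht

theorem sawtooth_coe {t : ℝ} (ht : t ∈ Ico (0 : ℝ) 1) :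
    sawtooth (t : UnitAddCircle) = 1 / 2 - t :=
  AddCircle.liftIco_zero_coe_apply ht

theorem continuous_greenKernel : Continuous greenKernel :=
  AddCircle.liftIco_zero_continuous (by norm_num) (by fun_prop)

theorem abs_greenKernel_le (x : UnitAddCircle) : |greenKernel x| ≤ 1 / 16 := by
  obtain ⟨t, ht, rfl⟩ := x.exists_coe_mem_Ico
  rw [greenKernel_coe ht, abs_le]
  constructor <;> nlinarith [ht.1, ht.2, sq_nonneg (t - 1 / 2)]

theorem greenKernel_neg (x : UnitAddCircle) : greenKernel (-x) = greenKernel x := by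
  obtain ⟨t, ht, rfl⟩ := x.exists_coe_mem_Ico
  rcases ht.1.eq_or_lt with rfl | h
  · simp
  · have e : -(t : UnitAddCircle) = ((1 - t : ℝ) : UnitAddCircle) := by
      rw [AddCircle.coe_sub, AddCircle.coe_period, zero_sub]
    rw [e, greenKernel_coe ht, greenKernel_coe ⟨by linarith [ht.2], by linarith⟩]
    ring

theorem greenKernel_sub_comm (x y : UnitAddCircle) : greenKernel (x - y) = greenKernel (y - x) := by
  rw [← greenKernel_neg, neg_sub]

theorem measurable_sawtooth : Measurable sawtooth := by
  have : sawtooth = fun x => 1 / 2 - (AddCircle.measurableEquivIco 1 0 x : ℝ) := rfl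
  rw [this]
  fun_prop

theorem abs_sawtooth_le (x : UnitAddCircle) : |sawtooth x| ≤ 1 := by
  obtain ⟨t, ht, rfl⟩ := x.exists_coe_mem_Ico
  rw [sawtooth_coe ht, abs_le]
  constructor <;> linarith [ht.1, ht.2]

theorem integral_shift_kernel_mul (H ψ : UnitAddCircle → ℝ) (y : UnitAddCircle) :
    ∫ x, H (x - y) * ψ x = ∫ z, H z * ψ (z + y) := by
  rw [← integral_add_right_eq_self (fun x => H (x - y) * ψ x) y]
  simp

theorem integral_circle_mul_coe {H ψ : UnitAddCircle → ℝ} {p : ℝ → ℝ}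
    (hp : ∀ t ∈ Ico (0 : ℝ) 1, H (t : UnitAddCircle) = p t) :
    ∫ x, H x * ψ x = ∫ t in (0 : ℝ)..1, p t * ψ (t : UnitAddCircle) := by
  rw [integral_circle_eq_intervalIntegral, intervalIntegral.integral_of_le zero_le_one,
    intervalIntegral.integral_of_le zero_le_one, integral_Ioc_eq_integral_Ioo,
    integral_Ioc_eq_integral_Ioo]
  refine setIntegral_congr_fun measurableSet_Ioo fun t ht => ?_
  simp only [hp t ⟨ht.1.le, ht.2⟩]

/-- Integration by parts on one period; the boundary term is the jump of `p` across the period. -/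
theorem CircleSmooth.integral_mul_circleDeriv {ψ : UnitAddCircle → ℝ} (hψ : CircleSmooth ψ)
    {p p' : ℝ → ℝ} (hp : ∀ t, HasDerivAt p (p' t) t) (hp' : Continuous p') :
    ∫ t in (0 : ℝ)..1, p t * circleDeriv ψ (t : UnitAddCircle) =
      (p 1 - p 0) * ψ 0 - ∫ t in (0 : ℝ)..1, p' t * ψ (t : UnitAddCircle) := by
  have hc : Continuous fun t : ℝ => circleDeriv ψ (t : UnitAddCircle) :=
    ContDiff.continuous hψ.deriv
  rw [intervalIntegral.integral_mul_deriv_eq_deriv_mul (u' := p')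
    (v := fun t : ℝ => ψ (t : UnitAddCircle)) (fun t _ => hp t) (fun t _ => hψ.hasDerivAt t)
    (hp'.intervalIntegrable _ _) (hc.intervalIntegrable _ _)]
  have h1 : ((1 : ℝ) : UnitAddCircle) = 0 := AddCircle.coe_period 1
  have h0 : ((0 : ℝ) : UnitAddCircle) = 0 := rfl
  rw [h1, h0]
  ring

theorem integral_greenKernel_mul_circleDeriv {ψ : UnitAddCircle → ℝ} (hψ : CircleSmooth ψ)
    (y : UnitAddCircle) :
    ∫ x, greenKernel (x - y) * circleDeriv ψ x = -∫ x, sawtooth (x - y) * ψ x := by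
  have hy := hψ.comp_add_right y
  rw [integral_shift_kernel_mul, integral_shift_kernel_mul,
    integral_circle_mul_coe (fun t ht => greenKernel_coe ht),
    integral_circle_mul_coe (fun t ht => sawtooth_coe ht)]
  have := hy.integral_mul_circleDeriv (p := fun t => t * (1 - t) / 2 - 1 / 16)
    (p' := fun t => 1 / 2 - t) (fun t => by
      have := ((((hasDerivAt_id' t).mul ((hasDerivAt_const t (1 : ℝ)).sub
        (hasDerivAt_id' t))).div_const 2).sub_const (1 / 16))
      convert! this using 1
      simp
      ring) (by fun_prop)
  rw [circleDeriv_comp_add_right] at this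
  rw [this]
  norm_num

theorem integral_sawtooth_mul_circleDeriv {ψ : UnitAddCircle → ℝ} (hψ : CircleSmooth ψ)
    (y : UnitAddCircle) :
    ∫ x, sawtooth (x - y) * circleDeriv ψ x = (∫ x, ψ x) - ψ y := by
  have hy := hψ.comp_add_right y
  rw [integral_shift_kernel_mul, integral_circle_mul_coe (fun t ht => sawtooth_coe ht)]
  have := hy.integral_mul_circleDeriv (p := fun t => 1 / 2 - t)
    (p' := fun t => -1) (fun t => by
      simpa using (hasDerivAt_id' t).const_sub (1 / 2 : ℝ)) (by fun_prop)
  rw [circleDeriv_comp_add_right] at this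
  rw [this, ← integral_add_right_eq_self ψ y, integral_circle_eq_intervalIntegral]
  norm_num
  ring

/-- The defining property of the Green kernel, `∂ₓₓ G = δ₀ - 1`. -/
theorem integral_greenKernel_mul_circleDeriv_two {ψ : UnitAddCircle → ℝ} (hψ : CircleSmooth ψ)
    (y : UnitAddCircle) :
    ∫ x, greenKernel (x - y) * circleDeriv (circleDeriv ψ) x = ψ y - ∫ x, ψ x := by
  rw [integral_greenKernel_mul_circleDeriv hψ.deriv, integral_sawtooth_mul_circleDeriv hψ]
  ring

/-- Fubini's theorem for a bounded kernel tested against integrable functions. -/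
theorem integral_mul_kernel_swap {X Y : Type*} [MeasurableSpace X] [MeasurableSpace Y]
    {μ : Measure X} {ν : Measure Y} [SFinite μ] [SFinite ν] {K : X → Y → ℝ}
    (hK : Measurable (Function.uncurry K)) {C : ℝ} (hC : ∀ x y, |K x y| ≤ C) {f : X → ℝ}
    {g : Y → ℝ} (hf : Integrable f μ) (hg : Integrable g ν) :
    ∫ x, f x * ∫ y, K x y * g y ∂ν ∂μ = ∫ y, g y * ∫ x, K x y * f x ∂μ ∂ν := by
  have h : Integrable (fun z : X × Y => f z.1 * g z.2 * K z.1 z.2) (μ.prod ν) :=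
    (hf.mul_prod hg).mul_bdd (c := C) hK.aestronglyMeasurable
      (Filter.Eventually.of_forall fun z => hC z.1 z.2)
  have := integral_integral_swap (f := fun x y => f x * g y * K x y) h
  calc _ = ∫ x, ∫ y, f x * g y * K x y ∂ν ∂μ := by
        refine integral_congr_ae (Filter.Eventually.of_forall fun x => ?_)
        simp only
        rw [← integral_const_mul]
        exact integral_congr_ae (Filter.Eventually.of_forall fun y => by simp only; ring)
    _ = _ := this
    _ = _ := by
        refine integral_congr_ae (Filter.Eventually.of_forall fun y => ?_)
        simp only
        rw [← integral_const_mul]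
        exact integral_congr_ae (Filter.Eventually.of_forall fun x => by simp only; ring)

/-- The Green potential `G * μ` of a measure on the circle, which solves
`∂ₓₓ (G * μ) = μ - μ(𝕊¹) dx`. -/
noncomputable def greenPotential (μ : Measure UnitAddCircle) (x : UnitAddCircle) : ℝ :=
  ∫ y, greenKernel (x - y) ∂μ

theorem continuous_greenPotential (μ : Measure UnitAddCircle) [IsFiniteMeasure μ] :
    Continuous (greenPotential μ) := by
  refine continuous_of_dominated (bound := fun _ => 1 / 16) (fun x => ?_) (fun x => ?_)
    (integrable_const _) ?_
  · exact (continuous_greenKernel.comp (by fun_prop)).aestronglyMeasurable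
  · exact Filter.Eventually.of_forall fun y => abs_greenKernel_le _
  · exact Filter.Eventually.of_forall fun y => continuous_greenKernel.comp (by fun_prop)

theorem abs_greenPotential_le (μ : Measure UnitAddCircle) [IsProbabilityMeasure μ]
    (x : UnitAddCircle) : |greenPotential μ x| ≤ 1 / 16 := by
  have := norm_integral_le_of_norm_le_const (μ := μ) (f := fun y => greenKernel (x - y))
    (C := 1 / 16) (Filter.Eventually.of_forall fun y => abs_greenKernel_le _)
  simpa [greenPotential] using this

theorem integral_greenPotential_mul {μ : Measure UnitAddCircle} [IsFiniteMeasure μ]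
    {ψ : UnitAddCircle → ℝ} (hψ : Integrable ψ) :
    ∫ x, greenPotential μ x * ψ x = ∫ y, (∫ x, greenKernel (x - y) * ψ x) ∂μ := by
  have := integral_mul_kernel_swap (μ := volume) (ν := μ) (K := fun x y => greenKernel (x - y))
    (continuous_greenKernel.comp (by fun_prop)).measurable (C := 1 / 16)
    (fun x y => abs_greenKernel_le _) hψ (integrable_const (1 : ℝ))
  simp only [mul_one, one_mul] at this
  simp only [greenPotential, mul_comm _ (ψ _)] at this ⊢
  exact this

/-- The weak form of `∂ₓₓ (G * μ) = μ - dx`. -/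
theorem integral_greenPotential_mul_circleDeriv_two {μ : Measure UnitAddCircle}
    [IsProbabilityMeasure μ] {ψ : UnitAddCircle → ℝ} (hψ : CircleSmooth ψ) :
    ∫ x, greenPotential μ x * circleDeriv (circleDeriv ψ) x = (∫ x, ψ x ∂μ) - ∫ x, ψ x := by
  rw [integral_greenPotential_mul (hψ.deriv.deriv.continuous.integrable_circle _)]
  simp only [integral_greenKernel_mul_circleDeriv_two hψ]
  rw [integral_sub (hψ.continuous.integrable_circle _) (integrable_const _)]
  simp

/-! ### Convolution and mollification -/

instance isProbabilityMeasure_volume_unitAddCircle :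
    IsProbabilityMeasure (volume : Measure UnitAddCircle) := ⟨UnitAddCircle.measure_univ⟩

theorem abs_integral_le_of_abs_le {X : Type*} [MeasurableSpace X] {μ : Measure X} {f g : X → ℝ}
    (hg : Integrable g μ) (h : ∀ᵐ x ∂μ, |f x| ≤ g x) : |∫ x, f x ∂μ| ≤ ∫ x, g x ∂μ := by
  rw [← Real.norm_eq_abs]
  exact norm_integral_le_of_norm_le hg h

/-- The convolution of two functions on the circle. -/
noncomputable def circleConv (K f : UnitAddCircle → ℝ) (x : UnitAddCircle) : ℝ :=
  ∫ y, K (x - y) * f y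

namespace CircleSmooth

variable {K f : UnitAddCircle → ℝ}

theorem hasDerivAt_circleConv (hK : CircleSmooth K) (hf : Integrable f) (t : ℝ) :
    HasDerivAt (fun r : ℝ => circleConv K f (r : UnitAddCircle))
      (circleConv (circleDeriv K) f (t : UnitAddCircle)) t := by
  obtain ⟨C, hC⟩ := hK.continuous.exists_abs_le_circle
  obtain ⟨C', hC'⟩ := hK.deriv.continuous.exists_abs_le_circle
  have hm : ∀ {H : UnitAddCircle → ℝ}, Continuous H → ∀ x : UnitAddCircle,
      AEStronglyMeasurable (fun y => H (x - y)) := fun hH x =>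
    (hH.comp (by fun_prop)).aestronglyMeasurable
  refine (hasDerivAt_integral_of_dominated_loc_of_deriv_le
    (F := fun (r : ℝ) y => K ((r : UnitAddCircle) - y) * f y)
    (F' := fun (r : ℝ) y => circleDeriv K ((r : UnitAddCircle) - y) * f y)
    (bound := fun y => C' * |f y|) Filter.univ_mem ?_ ?_ ?_ ?_ ?_ ?_).2
  · exact Filter.Eventually.of_forall fun r => (hm hK.continuous _).mul hf.aestronglyMeasurable
  · exact hf.bdd_mul (c := C) (hm hK.continuous _) (Filter.Eventually.of_forall fun y => hC _)
  · exact (hm hK.deriv.continuous _).mul hf.aestronglyMeasurable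
  · refine Filter.Eventually.of_forall fun y r _ => ?_
    rw [norm_mul]
    exact mul_le_mul_of_nonneg_right (hC' _) (abs_nonneg _)
  · exact hf.abs.const_mul _
  · refine Filter.Eventually.of_forall fun y r _ => HasDerivAt.mul_const ?_ _
    have := (hK.comp_add_right (-y)).hasDerivAt r
    rw [circleDeriv_comp_add_right] at this
    simpa only [sub_eq_add_neg] using this

theorem circleDeriv_circleConv (hK : CircleSmooth K) (hf : Integrable f) :
    circleDeriv (circleConv K f) = circleConv (circleDeriv K) f := by
  ext x
  obtain ⟨t, -, rfl⟩ := x.exists_coe_mem_Ico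
  rw [circleDeriv_coe]
  exact (hK.hasDerivAt_circleConv hf t).deriv

theorem circleConv (hK : CircleSmooth K) (hf : Integrable f) : CircleSmooth (circleConv K f) := by
  refine contDiff_infty.2 fun n => ?_
  induction n generalizing K with
  | zero =>
    exact contDiff_zero.2 (continuous_iff_continuousAt.2 fun t =>
      (hK.hasDerivAt_circleConv hf t).continuousAt)
  | succ n ih =>
    rw [Nat.cast_succ]
    refine contDiff_succ_iff_deriv.2
      ⟨fun t => (hK.hasDerivAt_circleConv hf t).differentiableAt, by simp, ?_⟩
    rw [show _root_.deriv (fun t : ℝ => _root_.circleConv K f (t : UnitAddCircle)) =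
      fun t : ℝ => _root_.circleConv (circleDeriv K) f (t : UnitAddCircle) from
      funext fun t => (hK.hasDerivAt_circleConv hf t).deriv]
    exact ih hK.deriv

end CircleSmooth

theorem IsWeakDeriv.circleConv_circleDeriv {f f₁ K : UnitAddCircle → ℝ} (h : IsWeakDeriv f f₁)
    (hK : CircleSmooth K) : circleConv (circleDeriv K) f = circleConv K f₁ := by
  ext x
  have := h.integral_eq _ (hK.comp_const_sub x)
  rw [circleDeriv_comp_const_sub] at this
  simp only [mul_neg, integral_neg, neg_inj] at this
  simpa only [circleConv, mul_comm] using this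

/-- Mollification commutes with weak derivatives. -/
theorem CircleSmooth.circleDeriv_two_circleConv {f f₁ f₂ K : UnitAddCircle → ℝ}
    (hK : CircleSmooth K) (h : IsWeakDeriv f f₁) (h' : IsWeakDeriv f₁ f₂) :
    circleDeriv (circleDeriv (_root_.circleConv K f)) = _root_.circleConv K f₂ := by
  rw [hK.circleDeriv_circleConv h.integrable_left, h.circleConv_circleDeriv hK,
    hK.circleDeriv_circleConv h.integrable_right, h'.circleConv_circleDeriv hK]

theorem abs_circleConv_le {K f : UnitAddCircle → ℝ} (hK : Continuous K) (hK0 : ∀ x, 0 ≤ K x)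
    (hK1 : ∫ x, K x = 1) {C : ℝ} (hf : ∀ᵐ x, |f x| ≤ C) (x : UnitAddCircle) :
    |circleConv K f x| ≤ C := by
  have hi : Integrable fun y => K (x - y) := (hK.comp (by fun_prop)).integrable_circle _
  calc |circleConv K f x| ≤ ∫ y, K (x - y) * C := by
        refine abs_integral_le_of_abs_le (hi.mul_const C) ?_
        filter_upwards [hf] with y hy
        rw [abs_mul, abs_of_nonneg (hK0 _)]
        exact mul_le_mul_of_nonneg_left hy (hK0 _)
    _ = C := by
        rw [integral_mul_const, integral_sub_left_eq_self K volume x, hK1, one_mul]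

/-- The function `1 + cos (2 π x)` on the circle, whose powers concentrate at the origin. -/
noncomputable def peakFunction (x : UnitAddCircle) : ℝ := 1 + (AddCircle.toCircle x : ℂ).re

theorem peakFunction_coe (t : ℝ) :
    peakFunction (t : UnitAddCircle) = 1 + Real.cos (2 * Real.pi * t) := by
  rw [peakFunction, AddCircle.toCircle_apply_mk, Circle.coe_exp, Complex.exp_ofReal_mul_I_re]
  simp

theorem smooth_peakFunction : CircleSmooth peakFunction := by
  unfold CircleSmooth
  simp only [peakFunction_coe]
  fun_prop

theorem peakFunction_nonneg (x : UnitAddCircle) : 0 ≤ peakFunction x := by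
  obtain ⟨t, -, rfl⟩ := x.exists_coe_mem_Ico
  rw [peakFunction_coe]
  linarith [Real.neg_one_le_cos (2 * Real.pi * t)]

theorem peakFunction_zero : peakFunction 0 = 2 := by
  rw [peakFunction, AddCircle.toCircle_zero]
  norm_num

theorem peakFunction_lt {x : UnitAddCircle} (hx : x ≠ 0) : peakFunction x < peakFunction 0 := by
  rw [peakFunction_zero]
  have h1 : ‖(AddCircle.toCircle x : ℂ)‖ = 1 := Circle.norm_coe _
  have h2 : (AddCircle.toCircle x : ℂ).re ≤ 1 := (Complex.re_le_norm _).trans_eq h1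
  refine lt_of_le_of_ne (by unfold peakFunction; linarith) fun h => hx ?_
  have h3 : (AddCircle.toCircle x : ℂ).re = 1 := by unfold peakFunction at h; linarith
  have h4 : (AddCircle.toCircle x : ℂ) = 1 := by
    have h5 := Complex.sq_norm_sub_sq_re (AddCircle.toCircle x : ℂ)
    rw [h1, h3] at h5
    refine Complex.ext (by simpa using h3) ?_
    simp only [Complex.one_im]
    nlinarith
  refine AddCircle.injective_toCircle one_ne_zero ?_
  rw [AddCircle.toCircle_zero]
  exact Circle.ext h4

theorem integral_peakFunction_pow_pos (n : ℕ) : 0 < ∫ x, peakFunction x ^ n := by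
  refine (integral_pos_iff_support_of_nonneg (fun x => pow_nonneg (peakFunction_nonneg x) n)
    ((smooth_peakFunction.continuous.pow n).integrable_circle _)).2 ?_
  refine IsOpen.measure_pos _ (smooth_peakFunction.continuous.pow n).isOpen_support ⟨0, ?_⟩
  simp [peakFunction_zero]

/-- The mollifier `(1 + cos (2 π x))ⁿ / ∫ (1 + cos (2 π y))ⁿ dy`. -/
noncomputable def mollifier (n : ℕ) (x : UnitAddCircle) : ℝ :=
  (∫ y, peakFunction y ^ n)⁻¹ * peakFunction x ^ n

theorem smooth_mollifier (n : ℕ) : CircleSmooth (mollifier n) :=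
  contDiff_const.mul (ContDiff.pow smooth_peakFunction n)

theorem mollifier_nonneg (n : ℕ) (x : UnitAddCircle) : 0 ≤ mollifier n x :=
  mul_nonneg (inv_nonneg.2 (integral_peakFunction_pow_pos n).le)
    (pow_nonneg (peakFunction_nonneg x) n)

theorem integral_mollifier (n : ℕ) : ∫ x, mollifier n x = 1 := by
  simp only [mollifier, integral_const_mul]
  exact inv_mul_cancel₀ (integral_peakFunction_pow_pos n).ne'

open Filter Topology in
theorem tendsto_circleConv_mollifier {f : UnitAddCircle → ℝ} (hf : Continuous f)
    (x : UnitAddCircle) : Tendsto (fun n => circleConv (mollifier n) f x) atTop (𝓝 (f x)) := by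
  have h := tendsto_setIntegral_pow_smul_of_unique_maximum_of_isCompact_of_continuousOn
    (μ := (volume : Measure UnitAddCircle)) (x₀ := 0) (g := fun z => f (x - z)) isCompact_univ
    smooth_peakFunction.continuous.continuousOn (fun y _ hy => peakFunction_lt hy)
    (fun y _ => peakFunction_nonneg y) (by simp [peakFunction_zero]) (by simp)
    (hf.comp (by fun_prop)).continuousOn
  simp only [Measure.restrict_univ, smul_eq_mul, sub_zero] at h
  refine h.congr fun n => ?_
  rw [circleConv, ← integral_sub_left_eq_self (fun y => mollifier n (x - y) * f y) volume x,
    ← integral_const_mul]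
  refine integral_congr_ae (Filter.Eventually.of_forall fun z => ?_)
  simp only [mollifier, sub_sub_cancel]
  ring

open Filter Topology in
theorem tendsto_integral_circleConv_mollifier {f : UnitAddCircle → ℝ} (hf : Continuous f)
    (μ : Measure UnitAddCircle) [IsFiniteMeasure μ] :
    Tendsto (fun n => ∫ x, circleConv (mollifier n) f x ∂μ) atTop (𝓝 (∫ x, f x ∂μ)) := by
  obtain ⟨C, hC⟩ := hf.exists_abs_le_circle
  refine tendsto_integral_of_dominated_convergence (fun _ => C) (fun n => ?_)
    (integrable_const _) (fun n => ?_) ?_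
  · exact ((smooth_mollifier n).circleConv
      (hf.integrable_circle _)).continuous.aestronglyMeasurable
  · exact Filter.Eventually.of_forall fun x => abs_circleConv_le (smooth_mollifier n).continuous
      (mollifier_nonneg n) (integral_mollifier n) (Filter.Eventually.of_forall hC) x
  · exact Filter.Eventually.of_forall fun x => tendsto_circleConv_mollifier hf x

/-- Probability measures on the circle are determined by smooth functions. -/
theorem ProbabilityMeasure.ext_of_integral_smooth {μ ν : ProbabilityMeasure UnitAddCircle}
    (h : ∀ ψ, CircleSmooth ψ → ∫ x, ψ x ∂(μ : Measure UnitAddCircle) =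
      ∫ x, ψ x ∂(ν : Measure UnitAddCircle)) : μ = ν := by
  refine Subtype.ext (show (μ : Measure UnitAddCircle) = ν from
    ext_of_forall_integral_eq_of_IsFiniteMeasure fun f => ?_)
  refine tendsto_nhds_unique (tendsto_integral_circleConv_mollifier f.continuous _) ?_
  simp only [h _ ((smooth_mollifier _).circleConv (f.continuous.integrable_circle _))]
  exact tendsto_integral_circleConv_mollifier f.continuous _

/-! ### The dual Sobolev norm of order `-2` -/

theorem signedIntegral_measureDiff (μ ν : ProbabilityMeasure UnitAddCircle)
    {f : UnitAddCircle → ℝ} (hf : Continuous f) :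
    ∫ᵛ x, f x ∂•(measureDiff μ ν) =
      (∫ x, f x ∂(μ : Measure UnitAddCircle)) - ∫ x, f x ∂(ν : Measure UnitAddCircle) := by
  have e : ∀ m : SignedMeasure UnitAddCircle, m.Integrable f := fun m => hf.integrable_circle _
  rw [measureDiff, VectorMeasure.integral_sub_vectorMeasure (e _) (e _),
    signedIntegral_toSignedMeasure, signedIntegral_toSignedMeasure]

/-- The mean-zero solution `g` of `∂ₓₓ g = μ₁ - μ₀`. -/
noncomputable def greenDiff (μ₀ μ₁ : ProbabilityMeasure UnitAddCircle) (x : UnitAddCircle) : ℝ :=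
  greenPotential μ₁ x - greenPotential μ₀ x

theorem continuous_greenDiff (μ₀ μ₁ : ProbabilityMeasure UnitAddCircle) :
    Continuous (greenDiff μ₀ μ₁) :=
  (continuous_greenPotential _).sub (continuous_greenPotential _)

theorem abs_greenDiff_le (μ₀ μ₁ : ProbabilityMeasure UnitAddCircle) (x : UnitAddCircle) :
    |greenDiff μ₀ μ₁ x| ≤ 1 / 8 := by
  refine (abs_sub _ _).trans ?_
  linarith [abs_greenPotential_le μ₁ x, abs_greenPotential_le μ₀ x]

theorem integral_greenDiff_mul_circleDeriv_two (μ₀ μ₁ : ProbabilityMeasure UnitAddCircle)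
    {ψ : UnitAddCircle → ℝ} (hψ : CircleSmooth ψ) :
    ∫ x, greenDiff μ₀ μ₁ x * circleDeriv (circleDeriv ψ) x =
      (∫ x, ψ x ∂(μ₁ : Measure UnitAddCircle)) - ∫ x, ψ x ∂(μ₀ : Measure UnitAddCircle) := by
  have hc := hψ.deriv.deriv.continuous
  simp only [greenDiff, sub_mul]
  rw [integral_sub (((continuous_greenPotential _).fun_mul hc).integrable_circle _)
    (((continuous_greenPotential _).fun_mul hc).integrable_circle _),
    integral_greenPotential_mul_circleDeriv_two hψ, integral_greenPotential_mul_circleDeriv_two hψ]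
  ring

theorem integral_greenPotential (μ : Measure UnitAddCircle) [IsProbabilityMeasure μ] :
    ∫ x, greenPotential μ x = ∫ x, greenKernel x := by
  have := integral_greenPotential_mul (μ := μ) (ψ := fun _ => 1) (integrable_const _)
  simp only [mul_one] at this
  rw [this]
  simp only [integral_sub_right_eq_self greenKernel]
  simp

theorem integral_greenDiff (μ₀ μ₁ : ProbabilityMeasure UnitAddCircle) :
    ∫ x, greenDiff μ₀ μ₁ x = 0 := by
  simp only [greenDiff]
  rw [integral_sub ((continuous_greenPotential _).integrable_circle _)
    ((continuous_greenPotential _).integrable_circle _), integral_greenPotential,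
    integral_greenPotential, sub_self]

theorem circleConv_greenKernel_eq (h : UnitAddCircle → ℝ) (x : UnitAddCircle) :
    circleConv greenKernel h x = ∫ y, greenKernel (y - x) * h y := by
  simp only [circleConv, greenKernel_sub_comm x]

theorem continuous_circleConv_greenKernel {h : UnitAddCircle → ℝ} (hh : Continuous h) :
    Continuous (circleConv greenKernel h) := by
  obtain ⟨C, hC⟩ := hh.exists_abs_le_circle
  refine continuous_of_dominated (bound := fun _ => 1 / 16 * C) (fun x => ?_) (fun x => ?_)
    (integrable_const _) ?_
  · exact ((continuous_greenKernel.comp (by fun_prop)).mul hh).aestronglyMeasurable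
  · refine Filter.Eventually.of_forall fun y => ?_
    rw [norm_mul]
    exact mul_le_mul (abs_greenKernel_le _) (hC y) (abs_nonneg _) (by norm_num)
  · exact Filter.Eventually.of_forall fun y =>
      (continuous_greenKernel.comp (by fun_prop)).mul continuous_const

/-- The Green potential of a continuous mean-zero function `h` solves `∂ₓₓ f = h` weakly. -/
theorem isHomSobolev_circleConv_greenKernel (p : ℝ≥0∞) {h : UnitAddCircle → ℝ} (hh : Continuous h)
    (h0 : ∫ x, h x = 0) :
    IsHomSobolev p ⟨circleConv greenKernel h, continuous_circleConv_greenKernel hh⟩ h := by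
  have hGc : Measurable (Function.uncurry fun x y : UnitAddCircle => greenKernel (x - y)) :=
    (continuous_greenKernel.comp (by fun_prop)).measurable
  have hSm : Measurable (Function.uncurry fun x y : UnitAddCircle => sawtooth (x - y)) :=
    measurable_sawtooth.comp (by fun_prop)
  have hhi := hh.integrable_circle volume
  obtain ⟨C, hC⟩ := hh.exists_abs_le_circle
  have hfc := continuous_circleConv_greenKernel hh
  obtain ⟨D, hD⟩ := hfc.exists_abs_le_circle
  have hf1m : Measurable (circleConv sawtooth h) := by
    refine StronglyMeasurable.measurable ?_
    refine StronglyMeasurable.integral_prod_right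
      (f := fun x y => sawtooth (x - y) * h y) ?_
    exact (hSm.mul (hh.measurable.comp measurable_snd)).stronglyMeasurable
  have hf1b : ∀ x, |circleConv sawtooth h x| ≤ C := fun x => by
    refine (abs_integral_le_of_abs_le (integrable_const C)
      (Filter.Eventually.of_forall fun y => ?_)).trans_eq (by simp)
    rw [abs_mul, ← one_mul C]
    exact mul_le_mul (abs_sawtooth_le _) (hC y) (abs_nonneg _) zero_le_one
  refine ⟨?_, ?_, ?_, circleConv sawtooth h, ?_, ⟨?_, ?_, ?_⟩, ⟨?_, ?_, ?_⟩⟩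
  · have := integral_mul_kernel_swap (μ := (volume : Measure UnitAddCircle)) hGc
      (fun x y => abs_greenKernel_le _) (integrable_const (1 : ℝ)) hhi
    simp only [one_mul, mul_one, integral_sub_right_eq_self greenKernel] at this
    rw [integral_mul_const, h0, zero_mul] at this
    exact this
  · exact MemLp.of_bound hfc.aestronglyMeasurable D (Filter.Eventually.of_forall hD)
  · exact MemLp.of_bound hh.aestronglyMeasurable C (Filter.Eventually.of_forall hC)
  · exact MemLp.of_bound hf1m.aestronglyMeasurable C (Filter.Eventually.of_forall hf1b)
  · exact hfc.integrable_circle _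
  · exact integrable_of_measurable_of_bounded hf1m hf1b
  · intro ψ hψ
    have e1 := integral_mul_kernel_swap (μ := (volume : Measure UnitAddCircle)) hGc
      (fun x y => abs_greenKernel_le _) (hψ.deriv.continuous.integrable_circle volume) hhi
    have e2 := integral_mul_kernel_swap (μ := (volume : Measure UnitAddCircle)) hSm
      (fun x y => abs_sawtooth_le _) (hψ.continuous.integrable_circle volume) hhi
    simp only [integral_greenKernel_mul_circleDeriv hψ, mul_neg, integral_neg] at e1
    rw [← e2] at e1
    simp only [ContinuousMap.coe_mk, circleConv, mul_comm _ (circleDeriv ψ _), mul_comm _ (ψ _)]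
    exact e1
  · exact integrable_of_measurable_of_bounded hf1m hf1b
  · exact hhi
  · intro ψ hψ
    have e2 := integral_mul_kernel_swap (μ := (volume : Measure UnitAddCircle)) hSm
      (fun x y => abs_sawtooth_le _) (hψ.deriv.continuous.integrable_circle volume) hhi
    simp only [integral_sawtooth_mul_circleDeriv hψ, mul_sub] at e2
    rw [integral_sub (hhi.mul_const _) ((hh.fun_mul hψ.continuous).integrable_circle _),
      integral_mul_const, h0, zero_mul, zero_sub] at e2
    simp only [circleConv, mul_comm _ (circleDeriv ψ _)]
    exact e2

/-- Duality: the `L²` norm of the mean-zero solution `g` of `∂ₓₓ g = μ₁ - μ₀` is at most the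
`Ḣ⁻²` norm of `μ₁ - μ₀`, as one sees by testing with the solution of `∂ₓₓ f = g / ‖g‖`. -/
theorem sqrt_integral_greenDiff_sq_le (μ₀ μ₁ : ProbabilityMeasure UnitAddCircle) :
    ENNReal.ofReal √(∫ x, greenDiff μ₀ μ₁ x ^ 2) ≤ dualSobolevNorm 2 (measureDiff μ₁ μ₀) := by
  set g := greenDiff μ₀ μ₁ with hg
  have hgc : Continuous g := continuous_greenDiff _ _
  set A := ∫ x, g x ^ 2 with hA
  have hA0 : 0 ≤ A := integral_nonneg fun x => sq_nonneg _
  rcases hA0.eq_or_lt with h | hpos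
  · simp [← h]
  have hsq : 0 < √A := Real.sqrt_pos.2 hpos
  set h : UnitAddCircle → ℝ := fun x => (√A)⁻¹ * g x with hh
  have hhc : Continuous h := continuous_const.mul hgc
  have h0 : ∫ x, h x = 0 := by
    rw [hh, integral_const_mul, hg, integral_greenDiff, mul_zero]
  have hnorm : eLpNorm h 2 volume ≤ 1 := by
    have hmem : MemLp h 2 (volume : Measure UnitAddCircle) :=
      (isHomSobolev_circleConv_greenKernel 2 hhc h0).memLp_snd
    rw [hmem.eLpNorm_eq_integral_rpow_norm (by norm_num) (by norm_num)]
    refine ENNReal.ofReal_le_one.2 ?_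
    have : ∫ x, ‖h x‖ ^ (2 : ℝ≥0∞).toReal = 1 := by
      simp only [ENNReal.toReal_ofNat, Real.rpow_two, Real.norm_eq_abs, sq_abs, hh, mul_pow]
      rw [integral_const_mul, ← hA, inv_pow, Real.sq_sqrt hA0, inv_mul_cancel₀ hpos.ne']
    rw [this, Real.one_rpow]
  refine le_trans ?_ (le_iSup₂_of_le _ h (le_iSup₂_of_le
    (isHomSobolev_circleConv_greenKernel 2 hhc h0) hnorm le_rfl))
  refine ENNReal.ofReal_le_ofReal (le_trans (le_of_eq ?_) (le_abs_self _))
  rw [signedIntegral_measureDiff _ _ (ContinuousMap.continuous _)]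
  simp only [ContinuousMap.coe_mk, circleConv_greenKernel_eq]
  rw [← integral_greenPotential_mul (hhc.integrable_circle _),
    ← integral_greenPotential_mul (hhc.integrable_circle _), ← integral_sub
      (((continuous_greenPotential _).fun_mul hhc).integrable_circle _)
      (((continuous_greenPotential _).fun_mul hhc).integrable_circle _)]
  have : ∀ x, greenPotential μ₁ x * h x - greenPotential μ₀ x * h x = (√A)⁻¹ * g x ^ 2 := by
    intro x
    simp only [hh, hg, greenDiff]
    ring
  simp only [this]
  rw [integral_const_mul, ← hA, inv_mul_eq_div, Real.div_sqrt]

/-- By mollification, `∫ f d(μ₁ - μ₀) = ∫ g ∂ₓₓ f` with `|g| ≤ 1 / 8`, and `‖∂ₓₓ f‖₁ ≤ ‖∂ₓₓ f‖₂`. -/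
theorem dualSobolevNorm_two_measureDiff_le (μ₀ μ₁ : ProbabilityMeasure UnitAddCircle) :
    dualSobolevNorm 2 (measureDiff μ₁ μ₀) ≤ ENNReal.ofReal (1 / 8) := by
  refine iSup_le fun f => iSup_le fun f₂ => iSup_le fun hf => iSup_le fun hf₂ =>
    ENNReal.ofReal_le_ofReal ?_
  obtain ⟨f₁, -, h1, h2⟩ := hf.weakDeriv
  have hint := h2.integrable_right
  have hL1 : ∫ x, |f₂ x| ≤ 1 := by
    have h3 : eLpNorm f₂ 1 volume ≤ 1 :=
      (eLpNorm_le_eLpNorm_of_exponent_le (by norm_num) hint.aestronglyMeasurable).trans hf₂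
    rw [eLpNorm_one_eq_lintegral_enorm, ← ofReal_integral_norm_eq_lintegral_enorm hint] at h3
    exact ENNReal.ofReal_le_one.1 h3
  rw [signedIntegral_measureDiff _ _ f.continuous]
  have hlim := ((tendsto_integral_circleConv_mollifier f.continuous
    (μ₁ : Measure UnitAddCircle)).sub (tendsto_integral_circleConv_mollifier f.continuous
    (μ₀ : Measure UnitAddCircle))).abs
  refine le_of_tendsto' hlim fun n => ?_
  rw [← integral_greenDiff_mul_circleDeriv_two _ _ ((smooth_mollifier n).circleConv
    h1.integrable_left), (smooth_mollifier n).circleDeriv_two_circleConv h1 h2]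
  obtain ⟨C, hC⟩ := (smooth_mollifier n).continuous.exists_abs_le_circle
  have hKm : Continuous (Function.uncurry fun x y : UnitAddCircle => mollifier n (x - y)) :=
    (smooth_mollifier n).continuous.comp (by fun_prop)
  have := integral_mul_kernel_swap (μ := (volume : Measure UnitAddCircle)) hKm.measurable
    (fun x y => hC _) ((continuous_greenDiff μ₀ μ₁).integrable_circle volume) hint
  rw [show (∫ x, greenDiff μ₀ μ₁ x * circleConv (mollifier n) f₂ x) = _ from this]
  calc _ ≤ ∫ y, |f₂ y| * (1 / 8) := by
        refine abs_integral_le_of_abs_le (hint.abs.mul_const _)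
          (Filter.Eventually.of_forall fun y => ?_)
        rw [abs_mul]
        refine mul_le_mul_of_nonneg_left ?_ (abs_nonneg _)
        have hi : Integrable fun x => mollifier n (x - y) :=
          ((smooth_mollifier n).continuous.comp (by fun_prop)).integrable_circle _
        calc _ ≤ ∫ x, mollifier n (x - y) * (1 / 8) := by
              refine abs_integral_le_of_abs_le (hi.mul_const _)
                (Filter.Eventually.of_forall fun x => ?_)
              rw [abs_mul, abs_of_nonneg (mollifier_nonneg _ _)]
              exact mul_le_mul_of_nonneg_left (abs_greenDiff_le _ _ _) (mollifier_nonneg _ _)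
          _ = 1 / 8 := by
              rw [integral_mul_const, integral_sub_right_eq_self (mollifier n),
                integral_mollifier, one_mul]
    _ ≤ 1 / 8 := by
        rw [integral_mul_const]
        linarith

/-! ### The fundamental lemma of the calculus of variations -/

theorem exists_Icc_of_tsupport_subset_Ioo {g : ℝ → ℝ} (hg : HasCompactSupport g)
    (hs : tsupport g ⊆ Ioo (0 : ℝ) 1) :
    ∃ a b : ℝ, 0 < a ∧ b < 1 ∧ ∀ s, s ∉ Icc a b → g s = 0 := by
  rcases (tsupport g).eq_empty_or_nonempty with h | h
  · exact ⟨1 / 2, 1 / 2, by norm_num, by norm_num, fun s _ =>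
      image_eq_zero_of_notMem_tsupport (by simp [h])⟩
  · obtain ⟨a, ha, ha'⟩ := IsCompact.exists_isLeast hg h
    obtain ⟨b, hb, hb'⟩ := IsCompact.exists_isGreatest hg h
    exact ⟨a, b, (hs ha).1, (hs hb).2, fun s hs' => image_eq_zero_of_notMem_tsupport
      fun h' => hs' ⟨ha' h', hb' h'⟩⟩

/-- An integral of a smooth function of vanishing mean and of compact support in `(0, 1)` has
compact support in `(0, 1)`. -/
theorem exists_primitive_of_integral_eq_zero {θ : ℝ → ℝ} (hθ : ContDiff ℝ ∞ θ)
    (h0 : ∫ s in (0 : ℝ)..1, θ s = 0) {a b : ℝ} (ha : 0 < a) (hb : b < 1)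
    (hs : ∀ s, s ∉ Icc a b → θ s = 0) :
    ∃ η : ℝ → ℝ, ContDiff ℝ ∞ η ∧ deriv η = θ ∧
      ∃ a b : ℝ, 0 < a ∧ b < 1 ∧ ∀ s, s ∉ Icc a b → η s = 0 := by
  have hd : ∀ t, HasDerivAt (fun t => ∫ s in (0 : ℝ)..t, θ s) (θ t) t := fun t =>
    hθ.continuous.integral_hasStrictDerivAt 0 t |>.hasDerivAt
  have hd' : deriv (fun t => ∫ s in (0 : ℝ)..t, θ s) = θ := funext fun t => (hd t).deriv
  refine ⟨fun t => ∫ s in (0 : ℝ)..t, θ s, ?_, hd', a, b, ha, hb, fun t ht => ?_⟩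
  · exact contDiff_infty_iff_deriv.2 ⟨fun t => (hd t).differentiableAt, hd'.symm ▸ hθ⟩
  · have hz : ∀ {c d : ℝ}, (∀ s ∈ uIcc c d, θ s = 0) → ∫ s in c..d, θ s = 0 := fun h => by
      rw [intervalIntegral.integral_congr h]
      simp
    simp only [mem_Icc, not_and_or, not_le] at ht
    show (∫ s in (0 : ℝ)..t, θ s) = 0
    rcases ht with h | h
    · refine hz fun s hs' => hs s fun h' => ?_
      rcases uIcc_subset_Icc (a₂ := min 0 t) (b₂ := max 0 t) ⟨by simp, by simp⟩
        ⟨by simp, by simp⟩ hs' with ⟨_, h2⟩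
      exact absurd (h2.trans_lt (max_lt ha h)) (not_lt.2 h'.1)
    · have := intervalIntegral.integral_add_adjacent_intervals
        (hθ.continuous.intervalIntegrable (μ := volume) 0 1)
        (hθ.continuous.intervalIntegrable (μ := volume) 1 t)
      rw [← this, h0, zero_add]
      refine hz fun s hs' => hs s fun h' => ?_
      rcases uIcc_subset_Icc (a₂ := min 1 t) (b₂ := max 1 t) ⟨by simp, by simp⟩
        ⟨by simp, by simp⟩ hs' with ⟨h2, _⟩
      exact absurd ((lt_min hb h).trans_le h2) (not_lt.2 h'.2)

/-- The lemma of du Bois-Reymond: a continuous function with an integrable distributional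
derivative is the integral of that derivative, up to the boundary. -/
theorem eq_add_intervalIntegral_of_distribDeriv {F H : ℝ → ℝ} (hF : ContinuousOn F (Icc 0 1))
    (hH : IntervalIntegrable H volume 0 1)
    (h : ∀ η : ℝ → ℝ, ContDiff ℝ ∞ η →
      (∃ a b : ℝ, 0 < a ∧ b < 1 ∧ ∀ s, s ∉ Icc a b → η s = 0) →
      ∫ s in (0 : ℝ)..1, (deriv η s * F s + η s * H s) = 0) {t : ℝ} (ht : t ∈ Icc (0 : ℝ) 1) :
    F t = F 0 + ∫ s in (0 : ℝ)..t, H s := by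
  set P : ℝ → ℝ := fun t => ∫ s in (0 : ℝ)..t, H s with hP
  have hPac : AbsolutelyContinuousOnInterval P 0 1 :=
    hH.absolutelyContinuousOnInterval_intervalIntegral (by simp)
  have hPc : ContinuousOn P (Icc 0 1) := by
    simpa [uIcc_of_le zero_le_one] using hPac.continuousOn
  have hP' : ∀ᵐ s, s ∈ uIcc (0 : ℝ) 1 → deriv P s = H s := by
    filter_upwards [hH.ae_hasDerivAt_integral] with s hs hs'
    exact (hs hs' 0 (by simp)).deriv
  -- The difference `E` has a vanishing distributional derivative, by integration by parts for `P`.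
  set E : ℝ → ℝ := fun t => F t - P t with hE
  have hEc : ContinuousOn E (Icc 0 1) := hF.sub hPc
  have hii : ∀ {u v : ℝ → ℝ}, ContinuousOn v (Icc 0 1) → Continuous u →
      IntervalIntegrable (fun s => u s * v s) volume 0 1 := fun hv hu =>
    (hu.continuousOn.mul hv).intervalIntegrable_of_Icc zero_le_one
  have key : ∀ η : ℝ → ℝ, ContDiff ℝ ∞ η →
      (∃ a b : ℝ, 0 < a ∧ b < 1 ∧ ∀ s, s ∉ Icc a b → η s = 0) →
      ∫ s in (0 : ℝ)..1, deriv η s * E s = 0 := by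
    rintro η hη ⟨a, b, ha, hb, hs⟩
    have hη0 : η 0 = 0 := hs 0 fun h => absurd h.1 (not_le.2 ha)
    have hη1 : η 1 = 0 := hs 1 fun h => absurd h.2 (not_le.2 hb)
    have hηd : Continuous (deriv η) := hη.continuous_deriv (by simp)
    have hηac : AbsolutelyContinuousOnInterval η 0 1 := by
      have := hηd.intervalIntegrable (μ := volume) 0 1
      have := this.absolutelyContinuousOnInterval_intervalIntegral (c := 0) (by simp)
      convert! this using 2 with t
      rw [intervalIntegral.integral_deriv_eq_sub (fun s _ => hη.differentiable (by simp) s)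
        (hηd.intervalIntegrable _ _), hη0, sub_zero]
    have e1 := hηac.integral_mul_deriv_eq_deriv_mul hPac
    rw [hη0, hη1] at e1
    have e2 : ∫ s in (0 : ℝ)..1, η s * deriv P s = ∫ s in (0 : ℝ)..1, η s * H s := by
      refine intervalIntegral.integral_congr_ae ?_
      filter_upwards [hP'] with s hs hs'
      rw [hs (uIoc_subset_uIcc hs')]
    have e3 := h η hη ⟨a, b, ha, hb, hs⟩
    rw [intervalIntegral.integral_add (hii hF hηd) (hH.continuousOn_mul hη.continuous.continuousOn),
      ← e2, e1] at e3
    simp only [hE, mul_sub]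
    rw [intervalIntegral.integral_sub (hii hF hηd) (hii hPc hηd)]
    linarith
  -- A multiple of the bump `χ` is subtracted from a test function to give it mean zero.
  let χ : ContDiffBump (1 / 2 : ℝ) := ⟨1 / 8, 1 / 4, by norm_num, by norm_num⟩
  have hχ : ContDiff ℝ ∞ χ := χ.contDiff
  have hχs : ∀ s, s ∉ Icc (1 / 4 : ℝ) (3 / 4) → χ s = 0 := fun s hs => by
    refine χ.zero_of_le_dist ?_
    by_contra hlt
    rw [not_le, Real.dist_eq, abs_lt] at hlt
    have h1 : χ.rOut = 1 / 4 := rfl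
    rw [h1] at hlt
    exact hs ⟨by linarith [hlt.1], by linarith [hlt.2]⟩
  set c₀ := ∫ s in (0 : ℝ)..1, χ s with hc₀
  have hc₀pos : 0 < c₀ := by
    have : c₀ = ∫ s, χ s := by
      rw [hc₀, intervalIntegral.integral_of_le zero_le_one]
      refine setIntegral_eq_integral_of_forall_compl_eq_zero fun s hs => hχs s fun h' => hs ?_
      exact ⟨by linarith [h'.1], by linarith [h'.2]⟩
    rw [this]
    exact χ.integral_pos
  set c := (∫ s in (0 : ℝ)..1, χ s * E s) / c₀ with hc
  have hae : ∀ᵐ s, s ∈ Ioo (0 : ℝ) 1 → E s - c = 0 := by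
    refine isOpen_Ioo.ae_eq_zero_of_integral_contDiff_smul_eq_zero ?_ fun ζ hζ hζc hζs => ?_
    · exact ((hEc.sub continuousOn_const).locallyIntegrableOn measurableSet_Icc).mono_set
        Ioo_subset_Icc_self
    · obtain ⟨a, b, ha, hb, hs⟩ := exists_Icc_of_tsupport_subset_Ioo hζc hζs
      set k := (∫ s in (0 : ℝ)..1, ζ s) / c₀ with hk
      obtain ⟨η, hη, hηd, hηs⟩ := exists_primitive_of_integral_eq_zero
        (θ := fun s => ζ s - k * χ s) (a := min a (1 / 4)) (b := max b (3 / 4))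
        (hζ.sub (contDiff_const.mul hχ)) (by
          rw [intervalIntegral.integral_sub (hζ.continuous.intervalIntegrable _ _)
            ((continuous_const.fun_mul hχ.continuous).intervalIntegrable _ _),
            intervalIntegral.integral_const_mul, ← hc₀, hk, div_mul_cancel₀ _ hc₀pos.ne', sub_self])
        (by positivity) (max_lt hb (by norm_num)) (fun s hs' => by
          rw [hs s fun h' => hs' ⟨(min_le_left _ _).trans h'.1, h'.2.trans (le_max_left _ _)⟩,
            hχs s fun h' => hs' ⟨(min_le_right _ _).trans h'.1, h'.2.trans (le_max_right _ _)⟩]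
          simp)
      have e := key η hη hηs
      simp only [hηd, sub_mul, mul_assoc] at e
      rw [intervalIntegral.integral_sub (hii hEc hζ.continuous)
        ((hii hEc hχ.continuous).const_mul k), intervalIntegral.integral_const_mul] at e
      have e' : ∫ s, ζ s • (E s - c) = ∫ s in (0 : ℝ)..1, ζ s * (E s - c) := by
        rw [intervalIntegral.integral_of_le zero_le_one]
        refine (setIntegral_eq_integral_of_forall_compl_eq_zero fun s hs' => ?_).symm
        rw [hs s fun h' => hs' ⟨by linarith [h'.1], by linarith [h'.2]⟩, zero_smul]
      simp only [e', mul_sub]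
      rw [intervalIntegral.integral_sub (hii hEc hζ.continuous)
        ((hζ.continuous.fun_mul continuous_const).intervalIntegrable _ _),
        intervalIntegral.integral_mul_const]
      have : k * ∫ s in (0 : ℝ)..1, χ s * E s = (∫ s in (0 : ℝ)..1, ζ s) * c := by
        rw [hk, hc]
        ring
      linarith
  have heq : EqOn E (fun _ => c) (Icc 0 1) := by
    refine Measure.eqOn_Icc_of_ae_eq volume zero_ne_one ?_ hEc continuousOn_const
    rw [Filter.EventuallyEq, ← restrict_Ioo_eq_restrict_Icc, ae_restrict_iff' measurableSet_Ioo]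
    filter_upwards [hae] with s hs hs'
    linarith [hs hs']
  have h1 := heq ht
  have h2 := heq (left_mem_Icc.2 zero_le_one)
  simp only [hE] at h1 h2
  have h3 : P 0 = 0 := by simp [hP]
  linarith

/-! ### Evolution of integrals along a connecting curve -/

/-- A weakly continuous curve of measures integrates a jointly continuous function to a continuous
function of time. -/
theorem continuousOn_integral_probabilityMeasure {S : Type*} [TopologicalSpace S]
    {μ : S → ProbabilityMeasure UnitAddCircle} {I : Set S} (hμ : ContinuousOn μ I)
    {φ : S → UnitAddCircle → ℝ} (hφ : Continuous (Function.uncurry φ)) :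
    ContinuousOn (fun s => ∫ x, φ s x ∂(μ s : Measure UnitAddCircle)) I := by
  let Φ : C(S, C(UnitAddCircle, ℝ)) := ContinuousMap.curry ⟨Function.uncurry φ, hφ⟩
  intro s₀ hs₀
  have h1 : Filter.Tendsto (fun s => ∫ x, φ s₀ x ∂(μ s : Measure UnitAddCircle))
      (nhdsWithin s₀ I) (nhds (∫ x, φ s₀ x ∂(μ s₀ : Measure UnitAddCircle))) :=
    ProbabilityMeasure.tendsto_iff_forall_integral_tendsto.1 (hμ s₀ hs₀)
      (BoundedContinuousFunction.mkOfCompact (Φ s₀))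
  have h2 : Filter.Tendsto (fun s => ∫ x, (φ s x - φ s₀ x) ∂(μ s : Measure UnitAddCircle))
      (nhdsWithin s₀ I) (nhds 0) := by
    refine squeeze_zero_norm (a := fun s => ‖Φ s - Φ s₀‖) (fun s => ?_) ?_
    · refine (norm_integral_le_of_norm_le_const (C := ‖Φ s - Φ s₀‖)
        (Filter.Eventually.of_forall fun x => ?_)).trans (by simp)
      exact (Φ s - Φ s₀).norm_coe_le_norm x
    · have : Filter.Tendsto (fun s => ‖Φ s - Φ s₀‖) (nhds s₀) (nhds ‖Φ s₀ - Φ s₀‖) :=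
        ((Φ.continuous.sub continuous_const).norm).tendsto s₀
      simpa using this.mono_left nhdsWithin_le_nhds
  have h3 := h2.add h1
  rw [zero_add] at h3
  refine h3.congr fun s => ?_
  have i : ∀ r, Integrable (φ r) (μ s : Measure UnitAddCircle) := fun r =>
    (Φ r).continuous.integrable_circle _
  rw [integral_sub (i s) (i s₀), sub_add_cancel]

theorem measurable_signedIntegral {S : Type*} [MeasurableSpace S]
    {m : S → SignedMeasure UnitAddCircle}
    (hm : ∀ B, MeasurableSet B → Measurable fun s => m s B) {φ : S → UnitAddCircle → ℝ}
    (hφ : ∀ s, Continuous (φ s)) (hφ' : ∀ x, Measurable fun s => φ s x) :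
    Measurable fun s => ∫ᵛ x, φ s x ∂•(m s) := by
  -- The integrand is composed with simple functions `A n` which approximate the identity.
  let A : ℕ → SimpleFunc UnitAddCircle UnitAddCircle :=
    SimpleFunc.approxOn id measurable_id univ 0 (mem_univ _)
  have hA : ∀ x, Filter.Tendsto (fun n => A n x) Filter.atTop (nhds x) := fun x =>
    SimpleFunc.tendsto_approxOn measurable_id (mem_univ _) (by simp)
  have e : ∀ n s, ∫ᵛ x, φ s (A n x) ∂•(m s) =
      ∑ y ∈ (A n).range, φ s y * m s (A n ⁻¹' {y}) := fun n s => by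
    have e1 : ∀ x, φ s (A n x) =
        ∑ y ∈ (A n).range, (A n ⁻¹' {y}).indicator (fun _ => φ s y) x := fun x => by
      rw [Finset.sum_eq_single (A n x)]
      · simp
      · intro y _ hy
        simp [indicator, hy.symm]
      · intro h
        exact absurd ((A n).mem_range_self x) h
    simp only [e1]
    rw [VectorMeasure.integral_finsetSum]
    · refine Finset.sum_congr rfl fun y _ => ?_
      rw [VectorMeasure.integral_indicator_const (s_meas := (A n).measurableSet_fiber y)]
      simp
    · intro y _
      exact integrable_of_measurable_of_bounded (C := |φ s y|)
        (measurable_const.indicator ((A n).measurableSet_fiber y)) fun x => by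
          by_cases h : x ∈ A n ⁻¹' {y} <;> simp [indicator, h]
  refine measurable_of_tendsto_metrizable (f := fun n s => ∫ᵛ x, φ s (A n x) ∂•(m s))
    (fun n => ?_) (tendsto_pi_nhds.2 fun s => ?_)
  · simp only [e]
    exact Finset.measurable_sum _ fun y _ => (hφ' y).mul (hm _ ((A n).measurableSet_fiber y))
  · obtain ⟨C, hC⟩ := (hφ s).exists_abs_le_circle
    refine VectorMeasure.tendsto_integral_filter_of_norm_le_const (Filter.Eventually.of_forall
      fun n => ((hφ s).measurable.comp (A n).measurable).aestronglyMeasurable)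
      ⟨C, Filter.Eventually.of_forall fun n => Filter.Eventually.of_forall fun x => hC _⟩
      (Filter.Eventually.of_forall fun x => ((hφ s).tendsto x).comp (hA x))

theorem sq_integral_le {X : Type*} [MeasurableSpace X] {μ : Measure X} [IsProbabilityMeasure μ]
    {f : X → ℝ} (hf : MemLp f 2 μ) : (∫ x, f x ∂μ) ^ 2 ≤ ∫ x, f x ^ 2 ∂μ := by
  set c := ∫ x, f x ∂μ with hc
  have h : 0 ≤ ∫ x, (f x - c) ^ 2 ∂μ := integral_nonneg fun x => sq_nonneg _
  have i1 := hf.integrable one_le_two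
  have i2 : Integrable (fun x => f x ^ 2 - 2 * c * f x) μ :=
    hf.integrable_sq.sub (i1.const_mul _)
  have e : ∀ x, (f x - c) ^ 2 = (f x ^ 2 - 2 * c * f x) + c ^ 2 := fun x => by ring
  simp only [e] at h
  rw [integral_add i2 (integrable_const _),
    integral_sub hf.integrable_sq (i1.const_mul _), integral_const_mul, ← hc] at h
  simp only [integral_const, probReal_univ, smul_eq_mul, one_mul] at h
  nlinarith

/-- A flux of finite action is square integrable in time against continuous functions. -/
theorem memLp_signedIntegral {μ : ℝ → ProbabilityMeasure UnitAddCircle}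
    {m : ℝ → SignedMeasure UnitAddCircle} {φ : ℝ → UnitAddCircle → ℝ}
    (hm : ∀ B, MeasurableSet B → Measurable fun s : Icc (0 : ℝ) 1 => m s B)
    (hA : action μ m < ⊤) (hφ : Continuous (Function.uncurry φ)) :
    MemLp (fun s => ∫ᵛ x, φ s x ∂•(m s)) 2 (volume.restrict (Icc 0 1)) ∧
    ∀ C, (∀ s ∈ Icc (0 : ℝ) 1, ∀ x, |φ s x| ≤ C) →
      ∫⁻ s in Icc (0 : ℝ) 1, ENNReal.ofReal ((∫ᵛ x, φ s x ∂•(m s)) ^ 2) ≤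
        ENNReal.ofReal (C ^ 2) * action μ m := by
  have hb : ∀ C, (∀ s ∈ Icc (0 : ℝ) 1, ∀ x, |φ s x| ≤ C) →
      ∫⁻ s in Icc (0 : ℝ) 1, ENNReal.ofReal ((∫ᵛ x, φ s x ∂•(m s)) ^ 2) ≤
        ENNReal.ofReal (C ^ 2) * action μ m := fun C hC => by
    rw [action, ← lintegral_const_mul' _ _ (by simp)]
    refine setLIntegral_mono' measurableSet_Icc fun s hs => ?_
    exact ofReal_sq_signedIntegral_le_actionDensity _ _ (hφ.comp (by fun_prop :
      Continuous fun x : UnitAddCircle => (s, x))).measurable (hC s hs)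
  refine ⟨?_, hb⟩
  have hmeas : AEMeasurable (fun s => ∫ᵛ x, φ s x ∂•(m s)) (volume.restrict (Icc 0 1)) :=
    aemeasurable_restrict_of_measurable_subtype measurableSet_Icc
      (measurable_signedIntegral (m := fun s : Icc (0 : ℝ) 1 => m s)
        (φ := fun s : Icc (0 : ℝ) 1 => φ s) hm
        (fun s => hφ.comp (by fun_prop : Continuous fun x : UnitAddCircle => ((s : ℝ), x)))
        fun x => (hφ.comp (by fun_prop : Continuous fun s : Icc (0 : ℝ) 1 =>
          ((s : ℝ), x))).measurable)
  rw [memLp_two_iff_integrable_sq hmeas.aestronglyMeasurable]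
  obtain ⟨C, hC⟩ := ((isCompact_Icc (a := (0 : ℝ)) (b := 1)).prod
    (isCompact_univ (X := UnitAddCircle))).exists_bound_of_continuousOn hφ.continuousOn
  refine ⟨(hmeas.pow_const 2).aestronglyMeasurable, ?_⟩
  rw [hasFiniteIntegral_iff_ofReal (Filter.Eventually.of_forall fun s => sq_nonneg _)]
  exact (hb C fun s hs x => hC (s, x) ⟨hs, mem_univ _⟩).trans_lt
    (ENNReal.mul_lt_top (by simp) hA)

/-- The rate of change of `∫ φ s dμₛ` along a solution of the continuity equation is integrable. -/
theorem intervalIntegrable_rate {μ : ℝ → ProbabilityMeasure UnitAddCircle}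
    {m : ℝ → SignedMeasure UnitAddCircle} {φ : ℝ → UnitAddCircle → ℝ}
    (hμ : ContinuousOn μ (Icc 0 1))
    (hm : ∀ B, MeasurableSet B → Measurable fun s : Icc (0 : ℝ) 1 => m s B)
    (hA : action μ m < ⊤) (hφ : SpaceTimeSmooth φ) :
    IntervalIntegrable (fun s => (∫ x, deriv (fun r => φ r x) s ∂(μ s : Measure UnitAddCircle)) +
      ∫ᵛ x, circleDeriv (circleDeriv (φ s)) x ∂•(m s)) volume 0 1 := by
  refine ((continuousOn_integral_probabilityMeasure hμ
    hφ.time_deriv.continuous).intervalIntegrable_of_Icc zero_le_one).add ?_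
  rw [intervalIntegrable_iff_integrableOn_Icc_of_le zero_le_one]
  exact (memLp_signedIntegral hm hA hφ.space_deriv.space_deriv.continuous).1.integrable one_le_two

/-- The continuity equation may be tested with the sum of its two integrands. -/
theorem solvesContinuityEq_of_integral_eq_zero {μ : ℝ → ProbabilityMeasure UnitAddCircle}
    {m : ℝ → SignedMeasure UnitAddCircle} (hμ : ContinuousOn μ (Icc 0 1))
    (hm : ∀ B, MeasurableSet B → Measurable fun s : Icc (0 : ℝ) 1 => m s B)
    (hA : action μ m < ⊤)
    (h : ∀ φ : ℝ → UnitAddCircle → ℝ, SpaceTimeSmooth φ → (∀ x, φ 0 x = 0) → (∀ x, φ 1 x = 0) →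
      ∫ s in (0 : ℝ)..1, ((∫ x, deriv (fun r => φ r x) s ∂(μ s : Measure UnitAddCircle)) +
        ∫ᵛ x, circleDeriv (circleDeriv (φ s)) x ∂•(m s)) = 0) :
    SolvesContinuityEq μ m := by
  rintro φ ⟨hφ, a, b, ha, hb, hs⟩
  have hφ : SpaceTimeSmooth φ := hφ
  rw [integral_Icc_eq_integral_Ioc, integral_Icc_eq_integral_Ioc,
    ← intervalIntegral.integral_of_le zero_le_one,
    ← intervalIntegral.integral_of_le zero_le_one, ← intervalIntegral.integral_add]
  · exact h φ hφ (hs 0 fun h' => absurd h'.1 (not_le.2 ha))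
      (hs 1 fun h' => absurd h'.2 (not_le.2 hb))
  · exact (continuousOn_integral_probabilityMeasure hμ
      hφ.time_deriv.continuous).intervalIntegrable_of_Icc zero_le_one
  · rw [intervalIntegrable_iff_integrableOn_Icc_of_le zero_le_one]
    exact (memLp_signedIntegral hm hA hφ.space_deriv.space_deriv.continuous).1.integrable
      one_le_two

namespace IsConnectingCurve

variable {μ₀ μ₁ : ProbabilityMeasure UnitAddCircle} {μ : ℝ → ProbabilityMeasure UnitAddCircle}
  {m : ℝ → SignedMeasure UnitAddCircle} {φ : ℝ → UnitAddCircle → ℝ}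

theorem intervalIntegrable_signedIntegral (h : IsConnectingCurve μ₀ μ₁ μ m)
    (hφ : Continuous (Function.uncurry φ)) :
    IntervalIntegrable (fun s => ∫ᵛ x, φ s x ∂•(m s)) volume 0 1 := by
  rw [intervalIntegrable_iff_integrableOn_Icc_of_le zero_le_one]
  exact (memLp_signedIntegral h.measurable h.finite_action hφ).1.integrable one_le_two

/-- The continuity equation, tested with a function which need not vanish at the end points. -/
theorem integral_eq_add (h : IsConnectingCurve μ₀ μ₁ μ m) (hφ : SpaceTimeSmooth φ) {t : ℝ}
    (ht : t ∈ Icc (0 : ℝ) 1) :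
    ∫ x, φ t x ∂(μ t : Measure UnitAddCircle) = ∫ x, φ 0 x ∂(μ 0 : Measure UnitAddCircle) +
      ∫ s in (0 : ℝ)..t, ((∫ x, deriv (fun r => φ r x) s ∂(μ s : Measure UnitAddCircle)) +
        ∫ᵛ x, circleDeriv (circleDeriv (φ s)) x ∂•(m s)) := by
  have hF := continuousOn_integral_probabilityMeasure h.continuousOn hφ.continuous
  refine eq_add_intervalIntegral_of_distribDeriv hF
    (intervalIntegrable_rate h.continuousOn h.measurable h.finite_action hφ) ?_ ht
  rintro η hη ⟨a, b, ha, hb, hs⟩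
  have e := h.continuityEq (fun s x => η s * φ s x)
    ⟨hφ.time_mul hη, a, b, ha, hb, fun s hs' x => by simp [hs s hs']⟩
  have hηd : Continuous (deriv η) := hη.continuous_deriv (by simp)
  have e1 : ∀ s, ∫ x, deriv (fun r => η r * φ r x) s ∂(μ s : Measure UnitAddCircle) =
      deriv η s * (∫ x, φ s x ∂(μ s : Measure UnitAddCircle)) +
        η s * ∫ x, deriv (fun r => φ r x) s ∂(μ s : Measure UnitAddCircle) := fun s => by
    have : ∀ x, deriv (fun r => η r * φ r x) s =
        deriv η s * φ s x + η s * deriv (fun r => φ r x) s := fun x =>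
      ((hη.differentiable (by simp) s).hasDerivAt.mul (hφ.hasDerivAt_time s x)).deriv
    simp only [this]
    rw [integral_add (((hφ.slice s).continuous.integrable_circle _).const_mul _)
      (((hφ.time_deriv.slice s).continuous.integrable_circle _).const_mul _),
      integral_const_mul, integral_const_mul]
  have e2 : ∀ s, ∫ᵛ x, circleDeriv (circleDeriv (fun x => η s * φ s x)) x ∂•(m s) =
      η s * ∫ᵛ x, circleDeriv (circleDeriv (φ s)) x ∂•(m s) := fun s => by
    rw [circleDeriv_const_mul, circleDeriv_const_mul]
    exact VectorMeasure.integral_fun_smul _ _ _ _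
  simp only [e1, e2, integral_Icc_eq_integral_Ioc] at e
  rw [← intervalIntegral.integral_of_le zero_le_one,
    ← intervalIntegral.integral_of_le zero_le_one, ← intervalIntegral.integral_add] at e
  · refine Eq.trans ?_ e
    refine intervalIntegral.integral_congr fun s _ => ?_
    ring
  · exact ((hηd.continuousOn.mul hF).add (hη.continuous.continuousOn.mul
      (continuousOn_integral_probabilityMeasure h.continuousOn
        hφ.time_deriv.continuous))).intervalIntegrable_of_Icc zero_le_one
  · exact (h.intervalIntegrable_signedIntegral
      hφ.space_deriv.space_deriv.continuous).continuousOn_mul hη.continuous.continuousOn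

theorem integral_sub_eq (h : IsConnectingCurve μ₀ μ₁ μ m) (hφ : SpaceTimeSmooth φ) {s t : ℝ}
    (hs : s ∈ Icc (0 : ℝ) 1) (ht : t ∈ Icc (0 : ℝ) 1) :
    (∫ x, φ t x ∂(μ t : Measure UnitAddCircle)) - ∫ x, φ s x ∂(μ s : Measure UnitAddCircle) =
      ∫ r in s..t, ((∫ x, deriv (fun r => φ r x) r ∂(μ r : Measure UnitAddCircle)) +
        ∫ᵛ x, circleDeriv (circleDeriv (φ r)) x ∂•(m r)) := by
  have hi := intervalIntegrable_rate h.continuousOn h.measurable h.finite_action hφ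
  have hi' : ∀ {t}, t ∈ Icc (0 : ℝ) 1 → IntervalIntegrable _ volume 0 t := fun ht =>
    hi.mono_set (by rw [uIcc_of_le zero_le_one, uIcc_of_le ht.1]; exact Icc_subset_Icc_right ht.2)
  rw [h.integral_eq_add hφ hs, h.integral_eq_add hφ ht,
    ← intervalIntegral.integral_interval_sub_left (hi' ht) (hi' hs)]
  ring

/-- The action controls the change of the integral of a smooth function `ψ`, by the continuity
equation and the Cauchy–Schwarz inequality in time and space. -/
theorem ofReal_sq_integral_sub_le (h : IsConnectingCurve μ₀ μ₁ μ m) {ψ : UnitAddCircle → ℝ}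
    (hψ : CircleSmooth ψ) {C : ℝ} (hC : ∀ x, |circleDeriv (circleDeriv ψ) x| ≤ C) :
    ENNReal.ofReal (((∫ x, ψ x ∂(μ₁ : Measure UnitAddCircle)) -
      ∫ x, ψ x ∂(μ₀ : Measure UnitAddCircle)) ^ 2) ≤ ENNReal.ofReal (C ^ 2) * action μ m := by
  have e := h.integral_sub_eq hψ.spaceTimeSmooth (left_mem_Icc.2 zero_le_one)
    (right_mem_Icc.2 zero_le_one)
  have hm := memLp_signedIntegral h.measurable h.finite_action
    (φ := fun _ => circleDeriv (circleDeriv ψ))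
    (hψ.deriv.deriv.continuous.comp continuous_snd)
  simp only [deriv_const, integral_zero, zero_add, h.initial, h.terminal] at e
  rw [e, intervalIntegral.integral_of_le zero_le_one, ← integral_Icc_eq_integral_Ioc]
  have : IsProbabilityMeasure (volume.restrict (Icc (0 : ℝ) 1)) := ⟨by simp⟩
  refine (ENNReal.ofReal_le_ofReal (sq_integral_le hm.1)).trans ?_
  rw [ofReal_integral_eq_lintegral_ofReal hm.1.integrable_sq
    (Filter.Eventually.of_forall fun s => sq_nonneg _)]
  exact hm.2 C fun s _ => hC

end IsConnectingCurve

/-! ### The infimum over connecting curves and the lower bound -/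

theorem diffusiveDist_sq_le_action {μ₀ μ₁ : ProbabilityMeasure UnitAddCircle}
    {μ : ℝ → ProbabilityMeasure UnitAddCircle} {m : ℝ → SignedMeasure UnitAddCircle}
    (h : IsConnectingCurve μ₀ μ₁ μ m) : diffusiveDist μ₀ μ₁ ^ 2 ≤ action μ m := by
  have : diffusiveDist μ₀ μ₁ ≤ action μ m ^ (1 / 2 : ℝ) := iInf₂_le_of_le μ m (iInf_le _ h)
  calc diffusiveDist μ₀ μ₁ ^ 2 ≤ (action μ m ^ (1 / 2 : ℝ)) ^ 2 := by gcongr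
    _ = action μ m := by
      rw [← ENNReal.rpow_natCast, ← ENNReal.rpow_mul]
      norm_num

theorem diffusiveDist_le_of_action_le {μ₀ μ₁ : ProbabilityMeasure UnitAddCircle}
    {μ : ℝ → ProbabilityMeasure UnitAddCircle} {m : ℝ → SignedMeasure UnitAddCircle}
    (h : IsConnectingCurve μ₀ μ₁ μ m) {a : ℝ≥0∞} (ha : action μ m ≤ a ^ 2) :
    diffusiveDist μ₀ μ₁ ≤ a :=
  (ENNReal.pow_le_pow_left_iff two_ne_zero).1 ((diffusiveDist_sq_le_action h).trans ha)

theorem exists_action_lt {μ₀ μ₁ : ProbabilityMeasure UnitAddCircle} {a : ℝ≥0∞}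
    (h : diffusiveDist μ₀ μ₁ < a) :
    ∃ (μ : ℝ → ProbabilityMeasure UnitAddCircle) (m : ℝ → SignedMeasure UnitAddCircle),
      IsConnectingCurve μ₀ μ₁ μ m ∧ action μ m < a ^ 2 := by
  simp only [diffusiveDist, iInf_lt_iff] at h
  obtain ⟨μ, m, hc, h⟩ := h
  refine ⟨μ, m, hc, ?_⟩
  have : (action μ m ^ (1 / 2 : ℝ)) ^ 2 < a ^ 2 := (ENNReal.pow_lt_pow_left_iff two_ne_zero).2 h
  rwa [← ENNReal.rpow_natCast, ← ENNReal.rpow_mul, show (1 / 2 : ℝ) * (2 : ℕ) = 1 by norm_num,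
    ENNReal.rpow_one] at this

theorem ofReal_abs_integral_sub_le {μ₀ μ₁ : ProbabilityMeasure UnitAddCircle}
    {ψ : UnitAddCircle → ℝ} (hψ : CircleSmooth ψ) {C : ℝ} (hC0 : 0 < C)
    (hC : ∀ x, |circleDeriv (circleDeriv ψ) x| ≤ C) :
    ENNReal.ofReal |(∫ x, ψ x ∂(μ₁ : Measure UnitAddCircle)) -
      ∫ x, ψ x ∂(μ₀ : Measure UnitAddCircle)| ≤ ENNReal.ofReal C * diffusiveDist μ₀ μ₁ := by
  have hle : ∀ a > diffusiveDist μ₀ μ₁, ENNReal.ofReal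
      |(∫ x, ψ x ∂(μ₁ : Measure UnitAddCircle)) - ∫ x, ψ x ∂(μ₀ : Measure UnitAddCircle)| ≤
      ENNReal.ofReal C * a := fun a ha => by
    obtain ⟨μ, m, h, hA⟩ := exists_action_lt ha
    rw [← ENNReal.pow_le_pow_left_iff two_ne_zero, mul_pow, ← ENNReal.ofReal_pow (abs_nonneg _),
      ← ENNReal.ofReal_pow hC0.le, sq_abs]
    exact (h.ofReal_sq_integral_sub_le hψ hC).trans (mul_le_mul_right hA.le _)
  rcases eq_or_ne (diffusiveDist μ₀ μ₁) ⊤ with hD | hD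
  · simp [hD, ENNReal.mul_top, hC0]
  · have : (nhdsWithin (diffusiveDist μ₀ μ₁) (Ioi (diffusiveDist μ₀ μ₁))).NeBot :=
      nhdsGT_neBot_of_exists_gt ⟨⊤, hD.lt_top⟩
    refine ge_of_tendsto (x := nhdsWithin _ (Ioi (diffusiveDist μ₀ μ₁)))
      ((ENNReal.Tendsto.const_mul (Filter.tendsto_id.mono_left nhdsWithin_le_nhds)
      (Or.inr ENNReal.ofReal_ne_top)))
      (Filter.eventually_of_mem self_mem_nhdsWithin fun a ha => hle a ha)

/-- The lower bound: convolution reduces it to smooth test functions. -/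
theorem dualSobolevNorm_top_le_diffusiveDist (μ₀ μ₁ : ProbabilityMeasure UnitAddCircle) :
    dualSobolevNorm ⊤ (measureDiff μ₀ μ₁) ≤ diffusiveDist μ₀ μ₁ := by
  refine iSup_le fun f => iSup_le fun f₂ => iSup_le fun hf => iSup_le fun hf₂ => ?_
  obtain ⟨f₁, -, h1, h2⟩ := hf.weakDeriv
  rw [signedIntegral_measureDiff _ _ f.continuous, abs_sub_comm]
  have hb : ∀ᵐ x, |f₂ x| ≤ 1 := by
    rw [eLpNorm_exponent_top] at hf₂
    filter_upwards [enorm_ae_le_eLpNormEssSup f₂ volume] with x hx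
    have := hx.trans hf₂
    rwa [← ofReal_norm, ENNReal.ofReal_le_one, Real.norm_eq_abs] at this
  have hlim := ((tendsto_integral_circleConv_mollifier f.continuous
    (μ₁ : Measure UnitAddCircle)).sub (tendsto_integral_circleConv_mollifier f.continuous
    (μ₀ : Measure UnitAddCircle))).abs
  refine le_of_tendsto' (ENNReal.tendsto_ofReal hlim) fun n => ?_
  have := ofReal_abs_integral_sub_le (μ₀ := μ₀) (μ₁ := μ₁) (C := 1)
    (hC0 := one_pos) ((smooth_mollifier n).circleConv h1.integrable_left) (fun x => by
      rw [(smooth_mollifier n).circleDeriv_two_circleConv h1 h2]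
      exact abs_circleConv_le (smooth_mollifier n).continuous (mollifier_nonneg n)
        (integral_mollifier n) hb x)
  simpa using this

theorem eq_of_diffusiveDist_eq_zero {μ₀ μ₁ : ProbabilityMeasure UnitAddCircle}
    (h : diffusiveDist μ₀ μ₁ = 0) : μ₀ = μ₁ := by
  refine ProbabilityMeasure.ext_of_integral_smooth fun ψ hψ => ?_
  obtain ⟨C, hC⟩ := hψ.deriv.deriv.continuous.exists_abs_le_circle
  have := ofReal_abs_integral_sub_le (μ₀ := μ₀) (μ₁ := μ₁) hψ
    (lt_max_of_lt_right one_pos) fun x => (hC x).trans (le_max_left C 1)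
  rw [h, mul_zero, nonpos_iff_eq_zero, ENNReal.ofReal_eq_zero] at this
  exact (sub_eq_zero.1 (abs_nonpos_iff.1 this)).symm

/-! ### Affine changes of time -/

theorem setLIntegral_actionDensity_comp_affine_le (μ : ℝ → ProbabilityMeasure UnitAddCircle)
    (m : ℝ → SignedMeasure UnitAddCircle) {α β : ℝ} (hα : α ≠ 0) {I : Set ℝ}
    (hI : MeasurableSet I) :
    ∫⁻ s in I, actionDensity (μ (α * s + β)) (α • m (α * s + β)) ≤
      ENNReal.ofReal |α| * ∫⁻ σ in (fun s => α * s + β) '' I, actionDensity (μ σ) (m σ) := by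
  have hd : ∀ x ∈ I, HasDerivWithinAt (fun s => α * s + β) α I x := fun x _ => by
    simpa using (((hasDerivAt_id x).const_mul α).add_const β).hasDerivWithinAt
  rw [lintegral_image_eq_lintegral_abs_deriv_mul hI hd fun x _ y _ h => by simpa [hα] using h,
    ← lintegral_const_mul' _ _ (by simp)]
  refine lintegral_mono fun s => (actionDensity_smul_le _ _ _).trans_eq ?_
  rw [← mul_assoc, ← ENNReal.ofReal_mul (abs_nonneg _), abs_mul_abs_self, sq]

namespace IsConnectingCurve

variable {μ₀ μ₁ : ProbabilityMeasure UnitAddCircle} {μ : ℝ → ProbabilityMeasure UnitAddCircle}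
  {m : ℝ → SignedMeasure UnitAddCircle} {φ : ℝ → UnitAddCircle → ℝ}

/-- The evolution of integrals along the curve `s ↦ (μ (α s + β), α m (α s + β))`. -/
theorem integral_sub_eq_comp_affine (h : IsConnectingCurve μ₀ μ₁ μ m) (hφ : SpaceTimeSmooth φ)
    {α β u v : ℝ} (hα : α ≠ 0) (hu : α * u + β ∈ Icc (0 : ℝ) 1) (hv : α * v + β ∈ Icc (0 : ℝ) 1) :
    ∫ s in u..v, ((∫ x, deriv (fun r => φ r x) s ∂(μ (α * s + β) : Measure UnitAddCircle)) +
      ∫ᵛ x, circleDeriv (circleDeriv (φ s)) x ∂•(α • m (α * s + β))) =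
    (∫ x, φ v x ∂(μ (α * v + β) : Measure UnitAddCircle)) -
      ∫ x, φ u x ∂(μ (α * u + β) : Measure UnitAddCircle) := by
  have hinv : ∀ s, α⁻¹ * (α * s + β) + -(α⁻¹ * β) = s := fun s => by field_simp; ring
  have e := h.integral_sub_eq (hφ.comp_affine α⁻¹ (-(α⁻¹ * β))) hu hv
  simp only [hinv] at e
  rw [e, ← intervalIntegral.smul_integral_comp_mul_add, ← intervalIntegral.integral_smul]
  refine intervalIntegral.integral_congr fun s _ => ?_
  have hd : ∀ x, deriv (fun r => φ (α⁻¹ * r + -(α⁻¹ * β)) x) (α * s + β) =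
      α⁻¹ * deriv (fun r => φ r x) s := fun x => by
    have h1 : HasDerivAt (fun r => α⁻¹ * r + -(α⁻¹ * β)) α⁻¹ (α * s + β) := by
      simpa using ((hasDerivAt_id (α * s + β)).const_mul α⁻¹).add_const (-(α⁻¹ * β))
    have h2 := hφ.hasDerivAt_time s x
    rw [← hinv s] at h2
    have := (HasDerivAt.comp (h := fun r => α⁻¹ * r + -(α⁻¹ * β)) (α * s + β) h2 h1).deriv
    rw [hinv s] at this
    rw [mul_comm α⁻¹ (deriv _ s), ← this]
    rfl
  simp only [hinv, hd, smul_eq_mul]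
  rw [integral_const_mul, mul_add, mul_inv_cancel_left₀ hα,
    VectorMeasure.integral_smul_vectorMeasure, smul_eq_mul]

/-- The part of a curve between the times `s` and `t`, run affinely; time is reversed if `t < s`. -/
theorem restrict (h : IsConnectingCurve μ₀ μ₁ μ m) {s t : ℝ} (hs : s ∈ Icc (0 : ℝ) 1)
    (ht : t ∈ Icc (0 : ℝ) 1) (hst : s ≠ t) :
    IsConnectingCurve (μ s) (μ t) (fun r => μ ((t - s) * r + s))
      (fun r => (t - s) • m ((t - s) * r + s)) ∧
    action (fun r => μ ((t - s) * r + s)) (fun r => (t - s) • m ((t - s) * r + s)) ≤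
      ENNReal.ofReal |t - s| * ∫⁻ σ in uIcc s t, actionDensity (μ σ) (m σ) := by
  have hα : t - s ≠ 0 := sub_ne_zero.2 hst.symm
  have hmaps : MapsTo (fun r => (t - s) * r + s) (Icc 0 1) (uIcc s t) := fun r hr => by
    have := (convex_uIcc s t) left_mem_uIcc right_mem_uIcc (sub_nonneg.2 hr.2) hr.1 (by ring)
    convert this using 1
    simp only [smul_eq_mul]
    ring
  have hsub : uIcc s t ⊆ Icc 0 1 := uIcc_subset_Icc hs ht
  have hact : action (fun r => μ ((t - s) * r + s)) (fun r => (t - s) • m ((t - s) * r + s)) ≤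
      ENNReal.ofReal |t - s| * ∫⁻ σ in uIcc s t, actionDensity (μ σ) (m σ) :=
    (setLIntegral_actionDensity_comp_affine_le μ m hα measurableSet_Icc).trans
      (mul_le_mul_right (lintegral_mono_set hmaps.image_subset) _)
  have hcont : ContinuousOn (fun r => μ ((t - s) * r + s)) (Icc 0 1) :=
    h.continuousOn.comp (by fun_prop) (hmaps.mono_right hsub)
  have hmeas : ∀ B, MeasurableSet B → Measurable
      fun r : Icc (0 : ℝ) 1 => ((t - s) • m ((t - s) * r + s)) B := fun B hB => by
    have h1 : Measurable fun r : Icc (0 : ℝ) 1 =>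
        (⟨(t - s) * r + s, hsub (hmaps r.2)⟩ : Icc (0 : ℝ) 1) :=
      Measurable.subtype_mk (by fun_prop)
    exact ((h.measurable B hB).comp h1).const_mul (t - s)
  have hfin : action (fun r => μ ((t - s) * r + s)) (fun r => (t - s) • m ((t - s) * r + s)) < ⊤ :=
    hact.trans_lt (ENNReal.mul_lt_top (by simp)
      ((lintegral_mono_set hsub).trans_lt h.finite_action))
  refine ⟨⟨hcont, hmeas, solvesContinuityEq_of_integral_eq_zero hcont hmeas hfin
    fun φ hφ h0 h1 => ?_, hfin, by simp, by simp⟩, hact⟩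
  rw [h.integral_sub_eq_comp_affine hφ hα (by simpa using hs) (by simpa using ht)]
  simp [h0, h1]

/-- The concatenation of two curves, with the first one run on `[0, τ]` and the second one on
`[τ, 1]`. -/
theorem exists_trans (h : IsConnectingCurve μ₀ μ₁ μ m) {μ₂ : ProbabilityMeasure UnitAddCircle}
    {ν : ℝ → ProbabilityMeasure UnitAddCircle} {n : ℝ → SignedMeasure UnitAddCircle}
    (h' : IsConnectingCurve μ₁ μ₂ ν n) {τ : ℝ} (hτ : 0 < τ) (hτ' : τ < 1) :
    ∃ (ρ : ℝ → ProbabilityMeasure UnitAddCircle) (k : ℝ → SignedMeasure UnitAddCircle),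
      IsConnectingCurve μ₀ μ₂ ρ k ∧ action ρ k ≤
        ENNReal.ofReal τ⁻¹ * action μ m + ENNReal.ofReal (1 - τ)⁻¹ * action ν n := by
  have hτ1 : 0 < 1 - τ := sub_pos.2 hτ'
  set α := τ⁻¹ with hα
  set α' := (1 - τ)⁻¹ with hα'
  set β' := -(α' * τ) with hβ'
  have hαp : 0 < α := inv_pos.2 hτ
  have hαp' : 0 < α' := inv_pos.2 hτ1
  have eτ : α * τ = 1 := inv_mul_cancel₀ hτ.ne'
  have eτ' : α' * (1 - τ) = 1 := inv_mul_cancel₀ hτ1.ne'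
  have maps1 : ∀ s ∈ Icc 0 τ, α * s + 0 ∈ Icc (0 : ℝ) 1 := fun s hs =>
    ⟨by have := mul_nonneg hαp.le hs.1; linarith, by nlinarith [hs.2]⟩
  have maps2 : ∀ s ∈ Icc τ 1, α' * s + β' ∈ Icc (0 : ℝ) 1 := fun s hs =>
    ⟨by nlinarith [hs.1], by nlinarith [hs.2]⟩
  let ρ : ℝ → ProbabilityMeasure UnitAddCircle := fun s =>
    if s ≤ τ then μ (α * s + 0) else ν (α' * s + β')
  let k : ℝ → SignedMeasure UnitAddCircle := fun s =>
    if s ≤ τ then α • m (α * s + 0) else α' • n (α' * s + β')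
  have hρ1 : ∀ s ∈ Icc 0 τ, ρ s = μ (α * s + 0) := fun s hs => if_pos hs.2
  have hρ2 : ∀ s ∈ Ioc τ 1, ρ s = ν (α' * s + β') := fun s hs => if_neg (not_le.2 hs.1)
  have hk1 : ∀ s ∈ Icc 0 τ, k s = α • m (α * s + 0) := fun s hs => if_pos hs.2
  have hk2 : ∀ s ∈ Ioc τ 1, k s = α' • n (α' * s + β') := fun s hs => if_neg (not_le.2 hs.1)
  have hρ2' : ∀ s ∈ Icc τ 1, ρ s = ν (α' * s + β') := fun s hs => by
    rcases hs.1.eq_or_lt with rfl | hlt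
    · rw [hρ1 _ ⟨hτ.le, le_rfl⟩, eτ, add_zero, hβ', add_neg_cancel, h'.initial, h.terminal]
    · exact hρ2 s ⟨hlt, hs.2⟩
  have hunion : Icc (0 : ℝ) τ ∪ Icc τ 1 = Icc 0 1 := Icc_union_Icc_eq_Icc hτ.le hτ'.le
  have hcont : ContinuousOn ρ (Icc 0 1) := by
    rw [← hunion]
    refine ContinuousOn.union_of_isClosed ?_ ?_ isClosed_Icc isClosed_Icc
    · exact (h.continuousOn.comp (by fun_prop) maps1).congr hρ1
    · exact (h'.continuousOn.comp (by fun_prop) maps2).congr hρ2'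
  have hmeas : ∀ B, MeasurableSet B → Measurable fun s : Icc (0 : ℝ) 1 => k s B := fun B hB => by
    have hS : MeasurableSet {s : Icc (0 : ℝ) 1 | (s : ℝ) ≤ τ} :=
      measurableSet_le measurable_subtype_coe measurable_const
    -- Measurability of the flux is known on `[0, 1]` only, so the time is clamped to that interval.
    have hq : ∀ x : ℝ, max 0 (min 1 x) ∈ Icc (0 : ℝ) 1 := fun x => by simp
    have g1 : Measurable fun s : Icc (0 : ℝ) 1 => α * m (max 0 (min 1 (α * s + 0))) B :=
      ((h.measurable B hB).comp (Measurable.subtype_mk (h := fun s : Icc (0 : ℝ) 1 => hq _)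
        (by fun_prop))).const_mul α
    have g2 : Measurable fun s : Icc (0 : ℝ) 1 => α' * n (max 0 (min 1 (α' * s + β'))) B :=
      ((h'.measurable B hB).comp (Measurable.subtype_mk (h := fun s : Icc (0 : ℝ) 1 => hq _)
        (by fun_prop))).const_mul α'
    have g3 : Measurable fun s : Icc (0 : ℝ) 1 => if (s : ℝ) ≤ τ then
        α * m (max 0 (min 1 (α * s + 0))) B else α' * n (max 0 (min 1 (α' * s + β'))) B :=
      Measurable.ite hS g1 g2
    convert g3 using 2 with s
    have hproj : ∀ x ∈ Icc (0 : ℝ) 1, max 0 (min 1 x) = x := fun x hx => by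
      rw [min_eq_right hx.2, max_eq_right hx.1]
    split_ifs with hs
    · rw [hproj _ (maps1 s ⟨s.2.1, hs⟩), hk1 s ⟨s.2.1, hs⟩]
      rfl
    · rw [not_le] at hs
      rw [hproj _ (maps2 s ⟨hs.le, s.2.2⟩), hk2 s ⟨hs, s.2.2⟩]
      rfl
  have hact : action ρ k ≤ ENNReal.ofReal α * action μ m + ENNReal.ofReal α' * action ν n := by
    have hu : Icc (0 : ℝ) 1 ⊆ Icc 0 τ ∪ Ioc τ 1 := (Icc_union_Ioc_eq_Icc hτ.le hτ'.le).symm.subset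
    refine (lintegral_mono_set hu).trans ((lintegral_union_le _ _ _).trans (add_le_add ?_ ?_))
    · rw [setLIntegral_congr_fun measurableSet_Icc fun s hs => by rw [hρ1 s hs, hk1 s hs]]
      refine (setLIntegral_actionDensity_comp_affine_le μ m hαp.ne' measurableSet_Icc).trans ?_
      rw [abs_of_pos hαp]
      exact mul_le_mul_right (lintegral_mono_set (image_subset_iff.2 fun s hs =>
        by exact maps1 s hs)) _
    · rw [setLIntegral_congr_fun measurableSet_Ioc fun s hs => by rw [hρ2 s hs, hk2 s hs]]
      refine (setLIntegral_actionDensity_comp_affine_le ν n hαp'.ne' measurableSet_Ioc).trans ?_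
      rw [abs_of_pos hαp']
      exact mul_le_mul_right (lintegral_mono_set (image_subset_iff.2 fun s hs =>
        by exact maps2 s (Ioc_subset_Icc_self hs))) _
  have hfin : action ρ k < ⊤ := hact.trans_lt (ENNReal.add_lt_top.2
    ⟨ENNReal.mul_lt_top (by simp) h.finite_action, ENNReal.mul_lt_top (by simp) h'.finite_action⟩)
  have e1 : α' * 1 + β' = 1 := by linarith
  refine ⟨ρ, k, ⟨hcont, hmeas, solvesContinuityEq_of_integral_eq_zero hcont hmeas hfin
    fun φ hφ h0 h1 => ?_, hfin, ?_, ?_⟩, hact⟩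
  · have hi := intervalIntegrable_rate hcont hmeas hfin hφ
    rw [← intervalIntegral.integral_add_adjacent_intervals (b := τ)
      (hi.mono_set (by
        rw [uIcc_of_le hτ.le, uIcc_of_le zero_le_one]
        exact Icc_subset_Icc_right hτ'.le))
      (hi.mono_set (by
        rw [uIcc_of_le hτ'.le, uIcc_of_le zero_le_one]
        exact Icc_subset_Icc_left hτ.le))]
    have i1 := h.integral_sub_eq_comp_affine hφ hαp.ne' (maps1 0 ⟨le_rfl, hτ.le⟩)
      (maps1 τ ⟨hτ.le, le_rfl⟩)
    have i2 := h'.integral_sub_eq_comp_affine hφ hαp'.ne' (maps2 τ ⟨le_rfl, hτ'.le⟩)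
      (maps2 1 ⟨hτ'.le, le_rfl⟩)
    rw [intervalIntegral.integral_congr_ae (g := fun s =>
        (∫ x, deriv (fun r => φ r x) s ∂(μ (α * s + 0) : Measure UnitAddCircle)) +
          ∫ᵛ x, circleDeriv (circleDeriv (φ s)) x ∂•(α • m (α * s + 0))) (a := 0) (b := τ), i1,
      intervalIntegral.integral_congr_ae (g := fun s =>
        (∫ x, deriv (fun r => φ r x) s ∂(ν (α' * s + β') : Measure UnitAddCircle)) +
          ∫ᵛ x, circleDeriv (circleDeriv (φ s)) x ∂•(α' • n (α' * s + β'))) (a := τ) (b := 1), i2]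
    · rw [← hρ2' τ ⟨le_rfl, hτ'.le⟩, ← hρ1 τ ⟨hτ.le, le_rfl⟩]
      simp [h0, h1]
    · refine Filter.Eventually.of_forall fun s hs => ?_
      rw [uIoc_of_le hτ'.le] at hs
      rw [hρ2 s hs, hk2 s hs]
    · refine Filter.Eventually.of_forall fun s hs => ?_
      rw [uIoc_of_le hτ.le] at hs
      rw [hρ1 s (Ioc_subset_Icc_self hs), hk1 s (Ioc_subset_Icc_self hs)]
  · rw [hρ1 0 ⟨le_rfl, hτ.le⟩, mul_zero, add_zero, h.initial]
  · rw [hρ2 1 ⟨hτ', le_rfl⟩, e1, h'.terminal]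

end IsConnectingCurve

/-! ### An explicit connecting curve -/

theorem SpaceTimeSmooth.hasDerivAt_integral {φ : ℝ → UnitAddCircle → ℝ} (hφ : SpaceTimeSmooth φ)
    (μ : Measure UnitAddCircle) [IsFiniteMeasure μ] (s : ℝ) :
    HasDerivAt (fun s => ∫ x, φ s x ∂μ) (∫ x, deriv (fun r => φ r x) s ∂μ) s := by
  obtain ⟨C, hC⟩ := ((isCompact_Icc (a := s - 1) (b := s + 1)).prod
    (isCompact_univ (X := UnitAddCircle))).exists_bound_of_continuousOn
      hφ.time_deriv.continuous.continuousOn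
  refine (hasDerivAt_integral_of_dominated_loc_of_deriv_le (s := Icc (s - 1) (s + 1))
    (bound := fun _ => C) (F' := fun s x => deriv (fun r => φ r x) s)
    (Icc_mem_nhds (by linarith) (by linarith))
    (Filter.Eventually.of_forall fun r => (hφ.slice r).continuous.aestronglyMeasurable)
    ((hφ.slice s).continuous.integrable_circle μ)
    (hφ.time_deriv.slice s).continuous.aestronglyMeasurable
    (Filter.Eventually.of_forall fun x r hr => hC (r, x) ⟨hr, mem_univ _⟩)
    (integrable_const C)
    (Filter.Eventually.of_forall fun x r _ => hφ.hasDerivAt_time r x)).2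

section ExplicitCurve

variable (δ s : ℝ)

/-- The weight of the initial measure at the time `s`. -/
noncomputable def initialWeight : ℝ :=
  (1 + Real.cos (Real.pi * s)) / 2 * (1 - δ * Real.sin (Real.pi * s) ^ 2)

/-- The weight of the terminal measure at the time `s`. -/
noncomputable def terminalWeight : ℝ :=
  (1 - Real.cos (Real.pi * s)) / 2 * (1 - δ * Real.sin (Real.pi * s) ^ 2)

/-- The weight of the uniform measure at the time `s`. -/
noncomputable def uniformWeight : ℝ := δ * Real.sin (Real.pi * s) ^ 2

/-- The derivative of `initialWeight`. -/
noncomputable def initialWeightDeriv : ℝ :=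
  -(Real.pi / 2 * Real.sin (Real.pi * s)) * (1 - δ * Real.sin (Real.pi * s) ^ 2) -
    (1 + Real.cos (Real.pi * s)) / 2 *
      (2 * Real.pi * δ * Real.sin (Real.pi * s) * Real.cos (Real.pi * s))

/-- The derivative of `terminalWeight`. -/
noncomputable def terminalWeightDeriv : ℝ :=
  Real.pi / 2 * Real.sin (Real.pi * s) * (1 - δ * Real.sin (Real.pi * s) ^ 2) -
    (1 - Real.cos (Real.pi * s)) / 2 *
      (2 * Real.pi * δ * Real.sin (Real.pi * s) * Real.cos (Real.pi * s))

theorem hasDerivAt_uniformWeight : HasDerivAt (uniformWeight δ)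
    (-(initialWeightDeriv δ s + terminalWeightDeriv δ s)) s := by
  have h1 : HasDerivAt (fun s => Real.pi * s) Real.pi s := by
    simpa using (hasDerivAt_id s).const_mul Real.pi
  refine ((h1.sin.pow 2).const_mul δ).congr_deriv ?_
  simp only [initialWeightDeriv, terminalWeightDeriv]
  push_cast
  ring

theorem hasDerivAt_initialWeight : HasDerivAt (initialWeight δ) (initialWeightDeriv δ s) s := by
  have h1 : HasDerivAt (fun s => Real.pi * s) Real.pi s := by
    simpa using (hasDerivAt_id s).const_mul Real.pi
  refine (((h1.cos.const_add 1).div_const 2).mul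
    (((h1.sin.pow 2).const_mul δ).const_sub 1)).congr_deriv ?_
  simp only [initialWeightDeriv, Pi.pow_apply]
  push_cast
  ring

theorem hasDerivAt_terminalWeight : HasDerivAt (terminalWeight δ) (terminalWeightDeriv δ s) s := by
  have h1 : HasDerivAt (fun s => Real.pi * s) Real.pi s := by
    simpa using (hasDerivAt_id s).const_mul Real.pi
  refine (((h1.cos.const_sub 1).div_const 2).mul
    (((h1.sin.pow 2).const_mul δ).const_sub 1)).congr_deriv ?_
  simp only [terminalWeightDeriv, Pi.pow_apply]
  push_cast
  ring

theorem initialWeight_add_terminalWeight_add_uniformWeight :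
    initialWeight δ s + terminalWeight δ s + uniformWeight δ s = 1 := by
  simp only [initialWeight, terminalWeight, uniformWeight]
  ring

variable {δ}

theorem uniformWeight_nonneg (hδ : 0 ≤ δ) : 0 ≤ uniformWeight δ s :=
  mul_nonneg hδ (sq_nonneg _)

theorem uniformWeight_le_one (hδ' : δ ≤ 1) : uniformWeight δ s ≤ 1 :=
  mul_le_one₀ hδ' (sq_nonneg _) (Real.sin_sq_le_one _)

theorem initialWeight_nonneg (hδ' : δ ≤ 1) : 0 ≤ initialWeight δ s :=
  mul_nonneg (by linarith [Real.neg_one_le_cos (Real.pi * s)])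
    (sub_nonneg.2 (uniformWeight_le_one s hδ'))

theorem terminalWeight_nonneg (hδ' : δ ≤ 1) : 0 ≤ terminalWeight δ s :=
  mul_nonneg (by linarith [Real.cos_le_one (Real.pi * s)])
    (sub_nonneg.2 (uniformWeight_le_one s hδ'))

/-- The density of the flux is controlled by the difference of the two potentials, and it vanishes
at the end points at the same rate as the square root of the weight of the uniform measure. -/
theorem abs_weightDeriv_combination_le (hδ : 0 ≤ δ) (hδ' : δ ≤ 1) {s : ℝ}
    (hs : s ∈ Icc (0 : ℝ) 1) {a b : ℝ} (ha : |a| ≤ 1 / 16) (hb : |b| ≤ 1 / 16) :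
    |initialWeightDeriv δ s * a + terminalWeightDeriv δ s * b| ≤
      Real.pi / 2 * Real.sin (Real.pi * s) * (|b - a| + δ / 4) := by
  have hS : 0 ≤ Real.sin (Real.pi * s) := Real.sin_nonneg_of_nonneg_of_le_pi
    (mul_nonneg Real.pi_pos.le hs.1) (mul_le_of_le_one_right Real.pi_pos.le hs.2)
  have hw := uniformWeight_le_one s hδ'
  have hw0 := uniformWeight_nonneg s hδ
  unfold uniformWeight at hw hw0
  set S := Real.sin (Real.pi * s)
  set c := Real.cos (Real.pi * s) with hc
  have hc1 : c ≤ 1 := Real.cos_le_one _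
  have hc2 : -1 ≤ c := Real.neg_one_le_cos _
  have hK : 0 ≤ Real.pi / 2 * S := mul_nonneg (by positivity) hS
  have e : initialWeightDeriv δ s * a + terminalWeightDeriv δ s * b =
      Real.pi / 2 * S * ((1 - δ * S ^ 2) * (b - a) -
        4 * δ * (c * ((1 + c) / 2 * a + (1 - c) / 2 * b))) := by
    simp only [initialWeightDeriv, terminalWeightDeriv]
    ring
  rw [e, abs_mul, abs_of_nonneg hK]
  refine mul_le_mul_of_nonneg_left ((abs_sub _ _).trans (add_le_add ?_ ?_)) hK
  · rw [abs_mul, abs_of_nonneg (sub_nonneg.2 hw)]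
    exact mul_le_of_le_one_left (abs_nonneg _) (by linarith)
  · have h1 : |(1 + c) / 2 * a + (1 - c) / 2 * b| ≤ 1 / 16 := by
      rw [abs_le] at ha hb ⊢
      constructor <;> nlinarith
    have h2 : |c * ((1 + c) / 2 * a + (1 - c) / 2 * b)| ≤ 1 / 16 := by
      rw [abs_mul]
      exact (mul_le_of_le_one_left (abs_nonneg _) (abs_le.2 ⟨hc2, hc1⟩)).trans h1
    rw [abs_mul, abs_of_nonneg (by positivity : 0 ≤ 4 * δ)]
    nlinarith

variable (μ₀ μ₁ : ProbabilityMeasure UnitAddCircle)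

/-- A mixture of the two end points and a bit of the uniform measure. -/
noncomputable def bridgeMeasure (δ s : ℝ) : Measure UnitAddCircle :=
  ENNReal.ofReal (initialWeight δ s) • (μ₀ : Measure UnitAddCircle) +
    ENNReal.ofReal (terminalWeight δ s) • (μ₁ : Measure UnitAddCircle) +
    ENNReal.ofReal (uniformWeight δ s) • volume

/-- The density of the flux of the curve `bridgeMeasure`. -/
noncomputable def bridgeFlux (δ s : ℝ) (x : UnitAddCircle) : ℝ :=
  initialWeightDeriv δ s * greenPotential μ₀ x + terminalWeightDeriv δ s * greenPotential μ₁ x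

theorem isProbabilityMeasure_bridgeMeasure (hδ : 0 ≤ δ) (hδ' : δ ≤ 1) :
    IsProbabilityMeasure (bridgeMeasure μ₀ μ₁ δ s) := ⟨by
  have h0 := initialWeight_nonneg s hδ'
  have h1 := terminalWeight_nonneg s hδ'
  simp only [bridgeMeasure, Measure.coe_add, Measure.coe_smul, Pi.add_apply, Pi.smul_apply,
    measure_univ, smul_eq_mul, mul_one]
  rw [← ENNReal.ofReal_add h0 h1, ← ENNReal.ofReal_add (add_nonneg h0 h1)
    (uniformWeight_nonneg s hδ), initialWeight_add_terminalWeight_add_uniformWeight,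
    ENNReal.ofReal_one]⟩

theorem integral_bridgeMeasure (hδ : 0 ≤ δ) (hδ' : δ ≤ 1) {f : UnitAddCircle → ℝ}
    (hf : Continuous f) : ∫ x, f x ∂(bridgeMeasure μ₀ μ₁ δ s) =
      initialWeight δ s * (∫ x, f x ∂(μ₀ : Measure UnitAddCircle)) +
        terminalWeight δ s * (∫ x, f x ∂(μ₁ : Measure UnitAddCircle)) +
        uniformWeight δ s * ∫ x, f x := by
  have i : ∀ (μ : Measure UnitAddCircle) [IsFiniteMeasure μ] (w : ℝ),
      Integrable f (ENNReal.ofReal w • μ) := fun μ _ w =>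
    (hf.integrable_circle μ).smul_measure ENNReal.ofReal_ne_top
  rw [bridgeMeasure, integral_add_measure ((i _ _).add_measure (i _ _)) (i _ _),
    integral_add_measure (i _ _) (i _ _), integral_smul_measure, integral_smul_measure,
    integral_smul_measure, ENNReal.toReal_ofReal (initialWeight_nonneg s hδ'),
    ENNReal.toReal_ofReal (terminalWeight_nonneg s hδ'),
    ENNReal.toReal_ofReal (uniformWeight_nonneg s hδ)]
  simp only [smul_eq_mul]

theorem continuous_bridgeFlux (δ : ℝ) : Continuous (bridgeFlux μ₀ μ₁ δ s) :=
  ((continuous_greenPotential _).const_mul _).add ((continuous_greenPotential _).const_mul _)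

theorem signedIntegral_bridgeFlux {ψ : UnitAddCircle → ℝ} (hψ : CircleSmooth ψ) (δ : ℝ) :
    ∫ᵛ x, circleDeriv (circleDeriv ψ) x ∂•((volume : Measure UnitAddCircle).withDensityᵥ
      (bridgeFlux μ₀ μ₁ δ s)) =
      initialWeightDeriv δ s * ((∫ x, ψ x ∂(μ₀ : Measure UnitAddCircle)) - ∫ x, ψ x) +
        terminalWeightDeriv δ s * ((∫ x, ψ x ∂(μ₁ : Measure UnitAddCircle)) - ∫ x, ψ x) := by
  obtain ⟨C, hC⟩ := hψ.deriv.deriv.continuous.exists_abs_le_circle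
  rw [signedIntegral_withDensity _ hψ.deriv.deriv.measurable hC
    (continuous_bridgeFlux s μ₀ μ₁ δ).measurable
    ((continuous_bridgeFlux s μ₀ μ₁ δ).integrable_circle _),
    ← integral_greenPotential_mul_circleDeriv_two hψ,
    ← integral_greenPotential_mul_circleDeriv_two hψ, ← integral_const_mul, ← integral_const_mul,
    ← integral_add]
  · refine integral_congr_ae (Filter.Eventually.of_forall fun x => ?_)
    simp only [bridgeFlux]
    ring
  all_goals exact (((continuous_greenPotential _).mul
    hψ.deriv.deriv.continuous).integrable_circle _).const_mul _

theorem actionDensity_bridge_le (hδ : 0 < δ) (hδ' : δ ≤ 1) {s : ℝ} (hs : s ∈ Ioo (0 : ℝ) 1) :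
    actionDensity ⟨bridgeMeasure μ₀ μ₁ δ s, isProbabilityMeasure_bridgeMeasure s μ₀ μ₁ hδ.le hδ'⟩
      ((volume : Measure UnitAddCircle).withDensityᵥ (bridgeFlux μ₀ μ₁ δ s)) ≤
    ENNReal.ofReal (Real.pi ^ 2 / (4 * δ) * (√(∫ x, greenDiff μ₀ μ₁ x ^ 2) + δ / 4) ^ 2) := by
  have hS : 0 < Real.sin (Real.pi * s) := Real.sin_pos_of_pos_of_lt_pi
    (mul_pos Real.pi_pos hs.1) (mul_lt_of_lt_one_right Real.pi_pos hs.2)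
  have hw : 0 < uniformWeight δ s := mul_pos hδ (pow_pos hS 2)
  have hc := continuous_bridgeFlux s μ₀ μ₁ δ
  have hg := continuous_greenDiff μ₀ μ₁
  refine (actionDensity_withDensity_le _ volume (c := ENNReal.ofReal (uniformWeight δ s)⁻¹)
    ENNReal.ofReal_ne_top ?_ hc.measurable (hc.integrable_circle _)).trans ?_
  · have h1 : ENNReal.ofReal (uniformWeight δ s) • (volume : Measure UnitAddCircle) ≤
        bridgeMeasure μ₀ μ₁ δ s := Measure.le_add_left le_rfl
    calc (volume : Measure UnitAddCircle) = ENNReal.ofReal (uniformWeight δ s)⁻¹ •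
        ENNReal.ofReal (uniformWeight δ s) • (volume : Measure UnitAddCircle) := by
          rw [smul_smul, ← ENNReal.ofReal_mul (inv_nonneg.2 hw.le), inv_mul_cancel₀ hw.ne',
            ENNReal.ofReal_one, one_smul]
      _ ≤ _ := by
        intro B
        simp only [Measure.smul_apply]
        exact mul_le_mul_right (h1 B) _
  · set N := √(∫ x, greenDiff μ₀ μ₁ x ^ 2)
    have hN : ∫ x, |greenDiff μ₀ μ₁ x| ≤ N := by
      have := sq_integral_le (μ := (volume : Measure UnitAddCircle))
        (f := fun x => |greenDiff μ₀ μ₁ x|)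
        ((memLp_two_iff_integrable_sq hg.abs.aestronglyMeasurable).2
          ((hg.abs.fun_pow 2).integrable_circle _))
      simp only [sq_abs] at this
      exact Real.le_sqrt_of_sq_le this
    have hN2 : N ^ 2 = ∫ x, greenDiff μ₀ μ₁ x ^ 2 :=
      Real.sq_sqrt (integral_nonneg fun x => sq_nonneg _)
    have hint : ∫ x, (|greenDiff μ₀ μ₁ x| + δ / 4) ^ 2 ≤ (N + δ / 4) ^ 2 := by
      have e : ∀ x, (|greenDiff μ₀ μ₁ x| + δ / 4) ^ 2 =
          greenDiff μ₀ μ₁ x ^ 2 + (δ / 2 * |greenDiff μ₀ μ₁ x| + (δ / 4) ^ 2) := fun x => by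
        rw [add_sq, sq_abs]
        ring
      have i3 : Integrable fun x => δ / 2 * |greenDiff μ₀ μ₁ x| + (δ / 4) ^ 2 :=
        Continuous.integrable_circle (by fun_prop) _
      simp only [e]
      rw [integral_add ((hg.fun_pow 2).integrable_circle _)
        i3,
        integral_add ((hg.abs.integrable_circle _).const_mul _) (integrable_const _),
        integral_const_mul, ← hN2]
      simp only [integral_const, probReal_univ, smul_eq_mul, one_mul]
      nlinarith
    rw [← ofReal_integral_eq_lintegral_ofReal ((hc.fun_pow 2).integrable_circle _)
      (Filter.Eventually.of_forall fun x => sq_nonneg _),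
      ← ENNReal.ofReal_mul (inv_nonneg.2 hw.le)]
    refine ENNReal.ofReal_le_ofReal ?_
    have hle : ∫ x, bridgeFlux μ₀ μ₁ δ s x ^ 2 ≤
        (Real.pi / 2 * Real.sin (Real.pi * s)) ^ 2 * (N + δ / 4) ^ 2 := by
      calc _ ≤ ∫ x, (Real.pi / 2 * Real.sin (Real.pi * s)) ^ 2 *
            (|greenDiff μ₀ μ₁ x| + δ / 4) ^ 2 := by
            refine integral_mono ((hc.fun_pow 2).integrable_circle _)
              (Continuous.integrable_circle (by fun_prop) _) fun x => ?_
            have := abs_weightDeriv_combination_le hδ.le hδ' (Ioo_subset_Icc_self hs)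
              (abs_greenPotential_le (μ₀ : Measure UnitAddCircle) x)
              (abs_greenPotential_le (μ₁ : Measure UnitAddCircle) x)
            simp only [← mul_pow]
            rw [← sq_abs]
            exact pow_le_pow_left₀ (abs_nonneg _) this 2
        _ ≤ _ := by
            rw [integral_const_mul]
            exact mul_le_mul_of_nonneg_left hint (sq_nonneg _)
    calc _ ≤ (uniformWeight δ s)⁻¹ *
        ((Real.pi / 2 * Real.sin (Real.pi * s)) ^ 2 * (N + δ / 4) ^ 2) :=
          mul_le_mul_of_nonneg_left hle (inv_nonneg.2 hw.le)
      _ = _ := by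
        unfold uniformWeight
        field_simp
        ring

/-- The curve `bridgeMeasure` connects its end points with a controlled action. -/
theorem diffusiveDist_sq_le_of_pos (hδ : 0 < δ) (hδ' : δ ≤ 1) :
    diffusiveDist μ₀ μ₁ ^ 2 ≤ ENNReal.ofReal
      (Real.pi ^ 2 / (4 * δ) * (√(∫ x, greenDiff μ₀ μ₁ x ^ 2) + δ / 4) ^ 2) := by
  let μ : ℝ → ProbabilityMeasure UnitAddCircle := fun s =>
    ⟨bridgeMeasure μ₀ μ₁ δ s, isProbabilityMeasure_bridgeMeasure s μ₀ μ₁ hδ.le hδ'⟩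
  let m : ℝ → SignedMeasure UnitAddCircle := fun s =>
    (volume : Measure UnitAddCircle).withDensityᵥ (bridgeFlux μ₀ μ₁ δ s)
  have hμi : ∀ s {f : UnitAddCircle → ℝ}, Continuous f →
      ∫ x, f x ∂(μ s : Measure UnitAddCircle) =
        initialWeight δ s * (∫ x, f x ∂(μ₀ : Measure UnitAddCircle)) +
        terminalWeight δ s * (∫ x, f x ∂(μ₁ : Measure UnitAddCircle)) +
        uniformWeight δ s * ∫ x, f x := fun s f hf =>
    integral_bridgeMeasure s μ₀ μ₁ hδ.le hδ' hf
  have hact : action μ m ≤ ENNReal.ofReal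
      (Real.pi ^ 2 / (4 * δ) * (√(∫ x, greenDiff μ₀ μ₁ x ^ 2) + δ / 4) ^ 2) := by
    unfold action
    rw [← restrict_Ioo_eq_restrict_Icc]
    refine (setLIntegral_mono' measurableSet_Ioo fun s hs =>
      actionDensity_bridge_le μ₀ μ₁ hδ hδ' hs).trans ?_
    simp
  have hfin : action μ m < ⊤ := hact.trans_lt ENNReal.ofReal_lt_top
  have hcont : Continuous μ := by
    rw [ProbabilityMeasure.continuous_iff_forall_continuous_integral]
    intro f
    simp only [hμi _ f.continuous]
    unfold initialWeight terminalWeight uniformWeight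
    fun_prop
  have hmeas : ∀ B, MeasurableSet B → Measurable fun s : Icc (0 : ℝ) 1 => m s B := fun B hB => by
    have e : ∀ s, m s B = initialWeightDeriv δ s * (∫ x in B, greenPotential μ₀ x) +
        terminalWeightDeriv δ s * ∫ x in B, greenPotential μ₁ x := fun s => by
      have i : ∀ μ : ProbabilityMeasure UnitAddCircle,
          IntegrableOn (greenPotential μ) B := fun μ =>
        ((continuous_greenPotential _).integrable_circle _).integrableOn
      rw [withDensityᵥ_apply ((continuous_bridgeFlux s μ₀ μ₁ δ).integrable_circle _) hB,
        ← integral_const_mul, ← integral_const_mul,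
        ← integral_add ((i μ₀).const_mul _) ((i μ₁).const_mul _)]
      rfl
    simp only [e, initialWeightDeriv, terminalWeightDeriv]
    fun_prop
  have hc : IsConnectingCurve μ₀ μ₁ μ m := by
    refine ⟨hcont.continuousOn, hmeas, solvesContinuityEq_of_integral_eq_zero hcont.continuousOn
      hmeas hfin fun φ hφ h0 h1 => ?_, hfin, ?_, ?_⟩
    · have hd : ∀ s, HasDerivAt (fun s => ∫ x, φ s x ∂(μ s : Measure UnitAddCircle))
          ((∫ x, deriv (fun r => φ r x) s ∂(μ s : Measure UnitAddCircle)) +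
            ∫ᵛ x, circleDeriv (circleDeriv (φ s)) x ∂•(m s)) s := fun s => by
        have e : (fun s => ∫ x, φ s x ∂(μ s : Measure UnitAddCircle)) = fun s => _ :=
          funext fun s => hμi s (hφ.slice s).continuous
        rw [e, hμi s (hφ.time_deriv.slice s).continuous,
          signedIntegral_bridgeFlux s μ₀ μ₁ (hφ.slice s) δ]
        refine ((((hasDerivAt_initialWeight δ s).mul (hφ.hasDerivAt_integral μ₀ s)).add
          ((hasDerivAt_terminalWeight δ s).mul (hφ.hasDerivAt_integral μ₁ s))).add
          ((hasDerivAt_uniformWeight δ s).mul (hφ.hasDerivAt_integral volume s))).congr_deriv ?_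
        ring
      rw [intervalIntegral.integral_eq_sub_of_hasDerivAt (fun s _ => hd s)
        (intervalIntegrable_rate hcont.continuousOn hmeas hfin hφ)]
      simp [h0, h1]
    · refine Subtype.ext ?_
      simp [μ, bridgeMeasure, initialWeight, terminalWeight, uniformWeight]
    · refine Subtype.ext ?_
      simp [μ, bridgeMeasure, initialWeight, terminalWeight, uniformWeight]
  exact (diffusiveDist_sq_le_action hc).trans hact

theorem diffusiveDist_sq_le :
    diffusiveDist μ₀ μ₁ ^ 2 ≤
      ENNReal.ofReal (Real.pi ^ 2 / 4 * √(∫ x, greenDiff μ₀ μ₁ x ^ 2)) := by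
  set N := √(∫ x, greenDiff μ₀ μ₁ x ^ 2) with hN
  have hN0 : 0 ≤ N := Real.sqrt_nonneg _
  have hN1 : N ≤ 1 / 8 := by
    rw [hN, Real.sqrt_le_left (by norm_num)]
    calc _ ≤ ∫ _ : UnitAddCircle, ((1 : ℝ) / 8) ^ 2 :=
          integral_mono (((continuous_greenDiff μ₀ μ₁).fun_pow 2).integrable_circle _)
            (integrable_const _) fun x => sq_le_sq' (abs_le.1 (abs_greenDiff_le _ _ x)).1
              (abs_le.1 (abs_greenDiff_le _ _ x)).2
      _ = _ := by simp
  have hle : ∀ M ∈ Ioc N (1 / 4), diffusiveDist μ₀ μ₁ ^ 2 ≤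
      ENNReal.ofReal (Real.pi ^ 2 / 4 * M) := fun M hM => by
    have hM0 : 0 < M := hN0.trans_lt hM.1
    -- For `N > 0` the choice `δ = 4 N` is optimal; `M > N` avoids `δ = 0`.
    refine (diffusiveDist_sq_le_of_pos μ₀ μ₁ (δ := 4 * M) (by linarith)
      (by linarith [hM.2])).trans (ENNReal.ofReal_le_ofReal ?_)
    calc _ ≤ Real.pi ^ 2 / (4 * (4 * M)) * (2 * M) ^ 2 := by
          rw [← hN]
          have : (0 : ℝ) ≤ Real.pi ^ 2 / (4 * (4 * M)) := by positivity
          gcongr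
          linarith [hM.1]
      _ = _ := by
          field_simp
          ring
  have hlim : Filter.Tendsto (fun M => ENNReal.ofReal (Real.pi ^ 2 / 4 * M))
      (nhdsWithin N (Ioi N)) (nhds (ENNReal.ofReal (Real.pi ^ 2 / 4 * N))) :=
    ((ENNReal.continuous_ofReal.comp (continuous_const_mul _)).tendsto N).mono_left
      nhdsWithin_le_nhds
  exact ge_of_tendsto hlim (Filter.eventually_of_mem
    (Ioc_mem_nhdsGT (by linarith : N < 1 / 4)) hle)

end ExplicitCurve

/-! ### The upper bound -/

theorem mul_le_inv_neg_log {n : ℝ} (h0 : 0 ≤ n) (h1 : n ≤ 1 / 8) :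
    Real.pi ^ 2 / 4 * n ≤ 2 * (-Real.log (n ^ 2))⁻¹ := by
  rcases h0.eq_or_lt with rfl | hn
  · simp
  have hlog : 0 < -Real.log n := neg_pos.2 (Real.log_neg hn (by linarith))
  have e : 2 * (-Real.log (n ^ 2))⁻¹ = (-Real.log n)⁻¹ := by
    rw [Real.log_pow]
    push_cast
    field_simp
  rw [e, ← one_div, le_div_iff₀ hlog]
  -- `n log (1 / n)` is at most `1 / e`.
  have h2 : -Real.log n * (n * Real.exp 1) ≤ 1 := by
    have h3 := Real.log_le_sub_one_of_pos (inv_pos.2 (mul_pos hn (Real.exp_pos 1)))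
    rw [Real.log_inv, Real.log_mul hn.ne' (Real.exp_pos 1).ne', Real.log_exp] at h3
    have h4 : -Real.log n ≤ (n * Real.exp 1)⁻¹ := by linarith
    calc _ ≤ (n * Real.exp 1)⁻¹ * (n * Real.exp 1) :=
          mul_le_mul_of_nonneg_right h4 (by positivity)
      _ = 1 := inv_mul_cancel₀ (by positivity)
  have hpi : Real.pi ^ 2 / 4 ≤ Real.exp 1 := by
    have h5 := Real.pi_lt_d2
    have h6 := Real.exp_one_gt_d9
    nlinarith [Real.pi_pos]
  calc Real.pi ^ 2 / 4 * n * -Real.log n = Real.pi ^ 2 / 4 * (n * -Real.log n) := by ring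
    _ ≤ Real.exp 1 * (n * -Real.log n) := mul_le_mul_of_nonneg_right hpi (by positivity)
    _ ≤ 1 := by linarith

theorem diffusiveDist_sq_le_inv_log (μ₀ μ₁ : ProbabilityMeasure UnitAddCircle) :
    diffusiveDist μ₀ μ₁ ^ 2 ≤ ENNReal.ofReal
      (2 * (-Real.log ((dualSobolevNorm 2 (measureDiff μ₁ μ₀)).toReal ^ 2))⁻¹) := by
  have hN := dualSobolevNorm_two_measureDiff_le μ₀ μ₁
  have h1 : (dualSobolevNorm 2 (measureDiff μ₁ μ₀)).toReal ≤ 1 / 8 :=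
    ENNReal.toReal_le_of_le_ofReal (by norm_num) hN
  refine (diffusiveDist_sq_le μ₀ μ₁).trans ((ENNReal.ofReal_le_ofReal ?_).trans
    (ENNReal.ofReal_le_ofReal (mul_le_inv_neg_log ENNReal.toReal_nonneg h1)))
  refine mul_le_mul_of_nonneg_left ?_ (by positivity)
  exact (ENNReal.ofReal_le_iff_le_toReal (hN.trans_lt ENNReal.ofReal_lt_top).ne).1
    (sqrt_integral_greenDiff_sq_le μ₀ μ₁)

/-! ### The metric -/

theorem diffusiveDist_ne_top (μ ν : ProbabilityMeasure UnitAddCircle) : diffusiveDist μ ν ≠ ⊤ :=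
  fun h => by
    have := diffusiveDist_sq_le μ ν
    simp [h] at this

theorem diffusiveDist_self (μ : ProbabilityMeasure UnitAddCircle) : diffusiveDist μ μ = 0 := by
  have := diffusiveDist_sq_le μ μ
  simpa [greenDiff] using this

theorem diffusiveDist_sq_le_setLIntegral {μ₀ μ₁ : ProbabilityMeasure UnitAddCircle}
    {μ : ℝ → ProbabilityMeasure UnitAddCircle} {m : ℝ → SignedMeasure UnitAddCircle}
    (h : IsConnectingCurve μ₀ μ₁ μ m) {s t : ℝ} (hs : s ∈ Icc (0 : ℝ) 1) (ht : t ∈ Icc (0 : ℝ) 1) :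
    diffusiveDist (μ s) (μ t) ^ 2 ≤
      ENNReal.ofReal |t - s| * ∫⁻ σ in uIcc s t, actionDensity (μ σ) (m σ) := by
  rcases eq_or_ne s t with rfl | hst
  · simp [diffusiveDist_self]
  · obtain ⟨h1, h2⟩ := h.restrict hs ht hst
    exact (diffusiveDist_sq_le_action h1).trans h2

theorem diffusiveDist_le_symm (μ ν : ProbabilityMeasure UnitAddCircle) :
    diffusiveDist ν μ ≤ diffusiveDist μ ν := by
  refine le_of_forall_gt_imp_ge_of_dense fun a ha => ?_
  obtain ⟨c, m, h, hA⟩ := exists_action_lt ha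
  have := diffusiveDist_sq_le_setLIntegral h (right_mem_Icc.2 zero_le_one)
    (left_mem_Icc.2 zero_le_one)
  rw [h.initial, h.terminal, uIcc_of_ge zero_le_one] at this
  simp only [zero_sub, abs_neg, abs_one, ENNReal.ofReal_one, one_mul] at this
  exact (ENNReal.pow_le_pow_left_iff two_ne_zero).1 (this.trans hA.le)

theorem diffusiveDist_comm (μ ν : ProbabilityMeasure UnitAddCircle) :
    diffusiveDist μ ν = diffusiveDist ν μ :=
  le_antisymm (diffusiveDist_le_symm ν μ) (diffusiveDist_le_symm μ ν)

theorem diffusiveDist_triangle (μ₀ μ₁ μ₂ : ProbabilityMeasure UnitAddCircle) :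
    diffusiveDist μ₀ μ₂ ≤ diffusiveDist μ₀ μ₁ + diffusiveDist μ₁ μ₂ := by
  refine ENNReal.le_of_forall_pos_le_add fun ε hε _ => ?_
  set a := (diffusiveDist μ₀ μ₁).toReal + ε / 2 with ha
  set b := (diffusiveDist μ₁ μ₂).toReal + ε / 2 with hb
  have hε' : (0 : ℝ) < ε := hε
  have ha0 : 0 < a := add_pos_of_nonneg_of_pos ENNReal.toReal_nonneg (by positivity)
  have hb0 : 0 < b := add_pos_of_nonneg_of_pos ENNReal.toReal_nonneg (by positivity)
  have h1 : diffusiveDist μ₀ μ₁ < ENNReal.ofReal a :=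
    (ENNReal.lt_ofReal_iff_toReal_lt (diffusiveDist_ne_top _ _)).2 (by linarith)
  have h2 : diffusiveDist μ₁ μ₂ < ENNReal.ofReal b :=
    (ENNReal.lt_ofReal_iff_toReal_lt (diffusiveDist_ne_top _ _)).2 (by linarith)
  obtain ⟨c, m, h, hA⟩ := exists_action_lt h1
  obtain ⟨c', m', h', hA'⟩ := exists_action_lt h2
  -- The time `a / (a + b)` makes the speed of the concatenation constant.
  obtain ⟨ρ, k, hρ, hA''⟩ := h.exists_trans h' (τ := a / (a + b)) (by positivity)
    ((div_lt_one (by positivity)).2 (by linarith))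
  calc diffusiveDist μ₀ μ₂ ≤ ENNReal.ofReal (a + b) := by
        refine diffusiveDist_le_of_action_le hρ (hA''.trans ?_)
        refine (add_le_add (mul_le_mul_right hA.le _) (mul_le_mul_right hA'.le _)).trans_eq ?_
        rw [← ENNReal.ofReal_pow ha0.le, ← ENNReal.ofReal_pow hb0.le,
          ← ENNReal.ofReal_pow (by positivity), ← ENNReal.ofReal_mul (by positivity),
          ← ENNReal.ofReal_mul, ← ENNReal.ofReal_add]
        · congr 1
          have : 1 - a / (a + b) = b / (a + b) := by field_simp; ring
          rw [this]
          field_simp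
        · positivity
        · have : 1 - a / (a + b) = b / (a + b) := by field_simp; ring
          rw [this]
          positivity
        · have : 1 - a / (a + b) = b / (a + b) := by field_simp; ring
          rw [this]
          positivity
    _ = diffusiveDist μ₀ μ₁ + diffusiveDist μ₁ μ₂ + ε := by
        rw [← ENNReal.ofReal_toReal (diffusiveDist_ne_top μ₀ μ₁),
          ← ENNReal.ofReal_toReal (diffusiveDist_ne_top μ₁ μ₂), ← ENNReal.ofReal_coe_nnreal,
          ← ENNReal.ofReal_add ENNReal.toReal_nonneg ENNReal.toReal_nonneg,
          ← ENNReal.ofReal_add (by positivity) hε'.le]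
        congr 1
        rw [ha, hb]
        ring

theorem tendsto_greenPotential {ι : Type*} {F : Filter ι} {ν : ι → ProbabilityMeasure UnitAddCircle}
    {μ : ProbabilityMeasure UnitAddCircle} (h : Filter.Tendsto ν F (nhds μ)) (x : UnitAddCircle) :
    Filter.Tendsto (fun i => greenPotential (ν i) x) F (nhds (greenPotential μ x)) :=
  ProbabilityMeasure.tendsto_iff_forall_integral_tendsto.1 h
    (BoundedContinuousFunction.mkOfCompact ⟨fun y => greenKernel (x - y),
      continuous_greenKernel.comp (by fun_prop)⟩)

/-- Weak convergence implies convergence in the diffusive transport distance, since the potentials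
converge in `L²`. -/
theorem tendsto_diffusiveDist_nhds (μ : ProbabilityMeasure UnitAddCircle) :
    Filter.Tendsto (fun ν => diffusiveDist ν μ) (nhds μ) (nhds 0) := by
  have h1 : Filter.Tendsto (fun ν : ProbabilityMeasure UnitAddCircle =>
      ∫ x, greenDiff ν μ x ^ 2) (nhds μ) (nhds (∫ _ : UnitAddCircle, (0 : ℝ))) := by
    refine tendsto_integral_filter_of_dominated_convergence (fun _ => ((1 : ℝ) / 8) ^ 2)
      (Filter.Eventually.of_forall fun ν =>
        ((continuous_greenDiff ν μ).pow 2).aestronglyMeasurable)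
      (Filter.Eventually.of_forall fun ν => Filter.Eventually.of_forall fun x => ?_)
      (integrable_const _) (Filter.Eventually.of_forall fun x => ?_)
    · rw [Real.norm_eq_abs, abs_pow]
      exact pow_le_pow_left₀ (abs_nonneg _) (abs_greenDiff_le _ _ _) 2
    · have := ((tendsto_greenPotential (Filter.tendsto_id (x := nhds μ)) x).const_sub
        (greenPotential μ x)).pow 2
      simpa [greenDiff] using this
  have h2 : Filter.Tendsto (fun ν => diffusiveDist ν μ ^ 2) (nhds μ) (nhds 0) := by
    have h3 : Filter.Tendsto (fun ν : ProbabilityMeasure UnitAddCircle =>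
        ENNReal.ofReal (Real.pi ^ 2 / 4 * √(∫ x, greenDiff ν μ x ^ 2))) (nhds μ)
        (nhds (ENNReal.ofReal (Real.pi ^ 2 / 4 * √0))) := by
      rw [integral_zero] at h1
      exact (ENNReal.continuous_ofReal.tendsto _).comp
        (((Real.continuous_sqrt.tendsto _).comp h1).const_mul _)
    rw [Real.sqrt_zero, mul_zero, ENNReal.ofReal_zero] at h3
    exact tendsto_of_tendsto_of_tendsto_of_le_of_le tendsto_const_nhds h3 (fun _ => zero_le)
      fun ν => diffusiveDist_sq_le ν μ
  have h4 := (ENNReal.continuous_rpow_const (y := (1 / 2 : ℝ))).tendsto 0 |>.comp h2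
  rw [ENNReal.zero_rpow_of_pos (by norm_num)] at h4
  refine h4.congr fun ν => ?_
  simp only [Function.comp]
  rw [← ENNReal.rpow_natCast, ← ENNReal.rpow_mul]
  norm_num

/-- A finite distance function which is continuous on a compact space metrizes that space. -/
theorem exists_metricSpace_of_compactSpace {X : Type*} [t : TopologicalSpace X] [CompactSpace X]
    (d : X → X → ℝ≥0∞) (hself : ∀ x, d x x = 0) (heq : ∀ {x y}, d x y = 0 → x = y)
    (hcomm : ∀ x y, d x y = d y x) (htri : ∀ x y z, d x z ≤ d x y + d y z)
    (hfin : ∀ x y, d x y ≠ ⊤)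
    (hcont : ∀ x, Filter.Tendsto (fun y => d y x) (nhds x) (nhds 0)) :
    ∃ M : MetricSpace X, (∀ x y, M.edist x y = d x y) ∧
      M.toUniformSpace.toTopologicalSpace = t ∧ @CompleteSpace X M.toUniformSpace := by
  let E : EMetricSpace X :=
    { edist := d
      edist_self := hself
      edist_comm := hcomm
      edist_triangle := htri
      eq_of_edist_eq_zero := heq }
  let M : MetricSpace X := EMetricSpace.toMetricSpace hfin
  have hle : t ≤ M.toUniformSpace.toTopologicalSpace := by
    refine le_of_nhds_le_nhds fun x => ?_
    refine (@Metric.nhds_basis_eball X _ x).ge_iff.2 fun ε hε => ?_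
    exact (hcont x).eventually (gt_mem_nhds hε)
  have heq' : M.toUniformSpace.toTopologicalSpace = t := by
    refine le_antisymm (fun U hU => ?_) hle
    have h1 : @IsCompact X t Uᶜ := (isClosed_compl_iff.2 hU).isCompact
    have h2 := @IsCompact.image X X t M.toUniformSpace.toTopologicalSpace _ id h1
      (continuous_id_iff_le.2 hle)
    rw [image_id] at h2
    exact (@isClosed_compl_iff X M.toUniformSpace.toTopologicalSpace U).1
      (@IsCompact.isClosed X M.toUniformSpace.toTopologicalSpace inferInstance _ h2)
  refine ⟨M, fun _ _ => rfl, heq', ?_⟩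
  have : @CompactSpace X M.toUniformSpace.toTopologicalSpace := by rw [heq']; infer_instance
  exact @complete_of_compact X M.toUniformSpace this

/-! ### Geodesics -/

/-- Near-optimality of a curve forces its speed to be nearly constant: this is the case of near
equality in the Cauchy–Schwarz inequality, for three time intervals of lengths `s`, `τ`, `r`. -/
theorem sq_sub_mul_le_of_near_optimal {x y z X Y Z L A s τ r : ℝ} (hs : 0 ≤ s) (hτ : 0 ≤ τ)
    (hr : 0 ≤ r) (hsum : s + τ + r = 1) (hL : 0 ≤ L) (hX : 0 ≤ X) (hZ : 0 ≤ Z)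
    (hx : x ^ 2 ≤ s * X) (hy : y ^ 2 ≤ τ * Y) (hz : z ^ 2 ≤ r * Z) (hA : X + Y + Z ≤ A)
    (hle : L ≤ x + y + z) : (y - τ * L) ^ 2 ≤ τ * (A - L ^ 2) := by
  have aux : ∀ {x X s : ℝ}, 0 ≤ s → 0 ≤ X → x ^ 2 ≤ s * X → 2 * L * x ≤ X + s * L ^ 2 := by
    intro x X s hs hX hx
    rcases hs.eq_or_lt with rfl | hs
    · have : x = 0 := by nlinarith [sq_nonneg x]
      rw [this]
      linarith
    · refine le_of_mul_le_mul_left ?_ hs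
      nlinarith [sq_nonneg (x - s * L)]
  have h1 := aux hs hX hx
  have h2 := aux hr hZ hz
  have h3 : Y ≤ A - L ^ 2 - τ * L ^ 2 + 2 * L * y := by
    have : r = 1 - s - τ := by linarith
    subst this
    nlinarith
  nlinarith

theorem sq_toReal_diffusiveDist_sub_le {μ₀ μ₁ : ProbabilityMeasure UnitAddCircle}
    {μ : ℝ → ProbabilityMeasure UnitAddCircle} {m : ℝ → SignedMeasure UnitAddCircle}
    (h : IsConnectingCurve μ₀ μ₁ μ m) {s t : ℝ} (hs : 0 ≤ s) (hst : s ≤ t) (ht : t ≤ 1) :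
    ((diffusiveDist (μ s) (μ t)).toReal - (t - s) * (diffusiveDist μ₀ μ₁).toReal) ^ 2 ≤
      (t - s) * ((action μ m).toReal - (diffusiveDist μ₀ μ₁).toReal ^ 2) := by
  have hfin : ∀ u v, 0 ≤ u → v ≤ 1 → ∫⁻ σ in Ioc u v, actionDensity (μ σ) (m σ) ≠ ⊤ :=
    fun u v hu hv => ((lintegral_mono_set fun r hr => (⟨hu.trans hr.1.le, hr.2.trans hv⟩ :
      r ∈ Icc (0 : ℝ) 1)).trans_lt h.finite_action).ne
  have hd : ∀ u v, 0 ≤ u → u ≤ v → v ≤ 1 → (diffusiveDist (μ u) (μ v)).toReal ^ 2 ≤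
      (v - u) * (∫⁻ σ in Ioc u v, actionDensity (μ σ) (m σ)).toReal := fun u v hu huv hv => by
    have := diffusiveDist_sq_le_setLIntegral h ⟨hu, huv.trans hv⟩ ⟨hu.trans huv, hv⟩
    rw [uIcc_of_le huv, ← restrict_Ioc_eq_restrict_Icc, abs_of_nonneg (sub_nonneg.2 huv)] at this
    have := ENNReal.toReal_mono (ENNReal.mul_ne_top (by simp) (hfin u v hu hv)) this
    rwa [ENNReal.toReal_pow, ENNReal.toReal_mul, ENNReal.toReal_ofReal (sub_nonneg.2 huv)] at this
  have ht0 := hs.trans hst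
  have hs1 := hst.trans ht
  have hA : (∫⁻ σ in Ioc 0 s, actionDensity (μ σ) (m σ)).toReal +
      (∫⁻ σ in Ioc s t, actionDensity (μ σ) (m σ)).toReal +
      (∫⁻ σ in Ioc t 1, actionDensity (μ σ) (m σ)).toReal ≤ (action μ m).toReal := by
    rw [← ENNReal.toReal_add (hfin _ _ le_rfl hs1) (hfin _ _ hs ht),
      ← lintegral_union measurableSet_Ioc (Ioc_disjoint_Ioc_of_le le_rfl),
      Ioc_union_Ioc_eq_Ioc hs hst, ← ENNReal.toReal_add (hfin _ _ le_rfl ht)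
      (hfin _ _ ht0 le_rfl), ← lintegral_union measurableSet_Ioc (Ioc_disjoint_Ioc_of_le le_rfl),
      Ioc_union_Ioc_eq_Ioc ht0 ht, action, ← restrict_Ioc_eq_restrict_Icc]
  refine sq_sub_mul_le_of_near_optimal (x := (diffusiveDist (μ 0) (μ s)).toReal)
    (z := (diffusiveDist (μ t) (μ 1)).toReal) (s := s - 0) (r := 1 - t) (by linarith)
    (by linarith) (by linarith) (by ring) ENNReal.toReal_nonneg ENNReal.toReal_nonneg
    ENNReal.toReal_nonneg (hd 0 s le_rfl hs hs1) (hd s t hs hst ht) (hd t 1 ht0 ht le_rfl) hA ?_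
  rw [h.initial, h.terminal, ← ENNReal.toReal_add (diffusiveDist_ne_top _ _)
    (diffusiveDist_ne_top _ _), ← ENNReal.toReal_add (ENNReal.add_ne_top.2
    ⟨diffusiveDist_ne_top _ _, diffusiveDist_ne_top _ _⟩) (diffusiveDist_ne_top _ _)]
  refine ENNReal.toReal_mono (ENNReal.add_ne_top.2 ⟨ENNReal.add_ne_top.2
    ⟨diffusiveDist_ne_top _ _, diffusiveDist_ne_top _ _⟩, diffusiveDist_ne_top _ _⟩) ?_
  exact (diffusiveDist_triangle _ (μ t) _).trans
    (add_le_add_left (diffusiveDist_triangle _ _ _) _)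

theorem tendsto_toReal_diffusiveDist {ι : Type*} {F : Filter ι}
    {ν ρ : ι → ProbabilityMeasure UnitAddCircle} {ν' ρ' : ProbabilityMeasure UnitAddCircle}
    (hν : Filter.Tendsto ν F (nhds ν')) (hρ : Filter.Tendsto ρ F (nhds ρ')) :
    Filter.Tendsto (fun i => (diffusiveDist (ν i) (ρ i)).toReal) F
      (nhds (diffusiveDist ν' ρ').toReal) := by
  have tri : ∀ a b c, (diffusiveDist a c).toReal ≤
      (diffusiveDist a b).toReal + (diffusiveDist b c).toReal := fun a b c => by
    rw [← ENNReal.toReal_add (diffusiveDist_ne_top _ _) (diffusiveDist_ne_top _ _)]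
    exact ENNReal.toReal_mono (ENNReal.add_ne_top.2
      ⟨diffusiveDist_ne_top _ _, diffusiveDist_ne_top _ _⟩) (diffusiveDist_triangle _ _ _)
  have h1 := (ENNReal.tendsto_toReal ENNReal.zero_ne_top).comp
    ((tendsto_diffusiveDist_nhds ν').comp hν)
  have h2 := (ENNReal.tendsto_toReal ENNReal.zero_ne_top).comp
    ((tendsto_diffusiveDist_nhds ρ').comp hρ)
  have h3 := h1.add h2
  rw [ENNReal.toReal_zero, add_zero] at h3
  rw [tendsto_iff_dist_tendsto_zero]
  refine squeeze_zero (fun _ => dist_nonneg) (fun i => ?_) h3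
  have a1 := tri (ν i) ν' (ρ i)
  have a2 := tri ν' ρ' (ρ i)
  have a3 := tri ν' (ν i) ρ'
  have a4 := tri (ν i) (ρ i) ρ'
  rw [diffusiveDist_comm ρ' (ρ i)] at a2
  rw [diffusiveDist_comm ν' (ν i)] at a3
  rw [Real.dist_eq, abs_le]
  simp only [Function.comp]
  constructor <;> linarith

/-- A limit of almost optimal curves is a geodesic. -/
theorem exists_diffusiveDist_geodesic (μ₀ μ₁ : ProbabilityMeasure UnitAddCircle) :
    ∃ γ : ℝ → ProbabilityMeasure UnitAddCircle, γ 0 = μ₀ ∧ γ 1 = μ₁ ∧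
      ∀ s ∈ Icc (0 : ℝ) 1, ∀ t ∈ Icc (0 : ℝ) 1,
        diffusiveDist (γ s) (γ t) = ENNReal.ofReal |s - t| * diffusiveDist μ₀ μ₁ := by
  set L := (diffusiveDist μ₀ μ₁).toReal with hL
  have hL0 : 0 ≤ L := ENNReal.toReal_nonneg
  have hex : ∀ n : ℕ, ∃ (μ : ℝ → ProbabilityMeasure UnitAddCircle)
      (m : ℝ → SignedMeasure UnitAddCircle), IsConnectingCurve μ₀ μ₁ μ m ∧
        (action μ m).toReal ≤ (L + 1 / ((n : ℝ) + 1)) ^ 2 := fun n => by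
    have hn : (0 : ℝ) < 1 / ((n : ℝ) + 1) := by positivity
    obtain ⟨μ, m, h, hA⟩ := exists_action_lt (a := ENNReal.ofReal (L + 1 / ((n : ℝ) + 1)))
      ((ENNReal.lt_ofReal_iff_toReal_lt (diffusiveDist_ne_top μ₀ μ₁)).2 (by linarith))
    refine ⟨μ, m, h, ENNReal.toReal_le_of_le_ofReal (sq_nonneg _) (hA.le.trans_eq ?_)⟩
    rw [ENNReal.ofReal_pow (by linarith)]
  choose c m hc hA using hex
  let U : Ultrafilter ℕ := Filter.hyperfilter ℕ
  have hlim : ∀ t, ∃ ν, Filter.Tendsto (fun n => c n t) U (nhds ν) := fun t => by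
    obtain ⟨ν, -, hν⟩ := isCompact_univ.ultrafilter_le_nhds (U.map fun n => c n t) (by simp)
    exact ⟨ν, hν⟩
  choose γ hγ using hlim
  have key : ∀ s t, 0 ≤ s → s ≤ t → t ≤ 1 →
      diffusiveDist (γ s) (γ t) = ENNReal.ofReal |s - t| * diffusiveDist μ₀ μ₁ := by
    intro s t hs hst ht
    have h1 : Filter.Tendsto (fun n => ((diffusiveDist (c n s) (c n t)).toReal - (t - s) * L) ^ 2) U
        (nhds (((diffusiveDist (γ s) (γ t)).toReal - (t - s) * L) ^ 2)) :=
      ((tendsto_toReal_diffusiveDist (hγ s) (hγ t)).sub_const _).pow 2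
    have h2 : Filter.Tendsto (fun n : ℕ => (t - s) * ((L + 1 / ((n : ℝ) + 1)) ^ 2 - L ^ 2)) U
        (nhds ((t - s) * ((L + 0) ^ 2 - L ^ 2))) :=
      ((((tendsto_one_div_add_atTop_nhds_zero_nat.mono_left
        Nat.hyperfilter_le_atTop).const_add L).pow 2).sub_const _).const_mul _
    have h3 := le_of_tendsto_of_tendsto' h1 h2 fun n =>
      (sq_toReal_diffusiveDist_sub_le (hc n) hs hst ht).trans (mul_le_mul_of_nonneg_left
        (sub_le_sub_right (hA n) _) (sub_nonneg.2 hst))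
    rw [add_zero, sub_self, mul_zero] at h3
    have h4 := pow_eq_zero_iff two_ne_zero |>.1 (le_antisymm h3 (sq_nonneg _))
    rw [← ENNReal.toReal_eq_toReal_iff' (diffusiveDist_ne_top _ _)
      (ENNReal.mul_ne_top ENNReal.ofReal_ne_top (diffusiveDist_ne_top _ _)), ENNReal.toReal_mul,
      ENNReal.toReal_ofReal (abs_nonneg _), abs_sub_comm, abs_of_nonneg (sub_nonneg.2 hst)]
    linarith
  refine ⟨γ, ?_, ?_, fun s hs t ht => ?_⟩
  · refine tendsto_nhds_unique (hγ 0) ?_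
    simp only [(hc _).initial]
    exact tendsto_const_nhds
  · refine tendsto_nhds_unique (hγ 1) ?_
    simp only [(hc _).terminal]
    exact tendsto_const_nhds
  · rcases le_total s t with h | h
    · exact key s t hs.1 h ht.2
    · rw [diffusiveDist_comm, abs_sub_comm]
      exact key t s ht.1 h hs.2

theorem mainTheorem2 :
    -- `𝔻` is a (finite) metric,
    (∃ M : MetricSpace (ProbabilityMeasure UnitAddCircle),
      (∀ μ ν, M.edist μ ν = diffusiveDist μ ν) ∧
      -- it metrizes weak convergence,
      M.toUniformSpace.toTopologicalSpace =
        weakTopology ∧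
      -- and it is complete.
      @CompleteSpace (ProbabilityMeasure UnitAddCircle) M.toUniformSpace) ∧
    -- The space is geodesic.
    (∀ μ₀ μ₁ : ProbabilityMeasure UnitAddCircle,
      ∃ γ : ℝ → ProbabilityMeasure UnitAddCircle, γ 0 = μ₀ ∧ γ 1 = μ₁ ∧
        ∀ s ∈ Icc (0 : ℝ) 1, ∀ t ∈ Icc (0 : ℝ) 1,
          diffusiveDist (γ s) (γ t) = ENNReal.ofReal |s - t| * diffusiveDist μ₀ μ₁) ∧
    -- Lower bound by the dual norm of `Ẇ^{2,∞}`.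
    (∀ μ₀ μ₁ : ProbabilityMeasure UnitAddCircle,
      dualSobolevNorm ∞ (measureDiff μ₀ μ₁) ^ 2 ≤ diffusiveDist μ₀ μ₁ ^ 2) ∧
    -- Upper bound by the norm of `Ḣ⁻²`, which is less than one, so that the logarithm is negative
    -- (for `μ₀ = μ₁` the right-hand side is zero).
    (∀ μ₀ μ₁ : ProbabilityMeasure UnitAddCircle,
      dualSobolevNorm 2 (measureDiff μ₁ μ₀) < 1 ∧
      diffusiveDist μ₀ μ₁ ^ 2 ≤
        ENNReal.ofReal
          (2 * (-Real.log ((dualSobolevNorm 2 (measureDiff μ₁ μ₀)).toReal ^ 2))⁻¹)) := by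
  refine ⟨exists_metricSpace_of_compactSpace diffusiveDist diffusiveDist_self
    eq_of_diffusiveDist_eq_zero diffusiveDist_comm diffusiveDist_triangle diffusiveDist_ne_top
    tendsto_diffusiveDist_nhds, exists_diffusiveDist_geodesic, fun μ₀ μ₁ => ?_, fun μ₀ μ₁ =>
    ⟨(dualSobolevNorm_two_measureDiff_le μ₀ μ₁).trans_lt ?_, diffusiveDist_sq_le_inv_log μ₀ μ₁⟩⟩
  · exact pow_le_pow_left' (dualSobolevNorm_top_le_diffusiveDist μ₀ μ₁) 2
  · rw [ENNReal.ofReal_lt_one]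
    norm_num
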